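/- Let $g=\frac{\sqrt5-1}{2}$. For $\alpha\in(0,1]$ put $\bar\alpha=\max(\alpha,1-\alpha)$ and let $A_\alpha:[0,\bar\alpha]\to[0,\bar\alpha]$ be Nakada's $\alpha$-continued fraction map, $A_\alpha(0)=0$ and $$A_\alpha(x)=\left|\frac1x-\left\lfloor\frac1x+1-\alpha\right\rfloor\right|\qquad(0<x\le\bar\alpha).$$ For $x\in\mathbb R\setminus\mathbb Q$ put $x_{\alpha,0}=\left|x-\lfloor x+1-\bar\alpha\rfloor\right|$, $x_{\alpha,j}=A_\alpha^j(x_{\alpha,0})$, $\beta_{\alpha,-1}(x)=1$ and $\beta_{\alpha,j}(x)=x_{\alpha,0}x_{\alpha,1}\cdots x_{\alpha,j}$ for $j\ge0$. The Wilton function is $$W_\alpha(x)=\sum_{j=0}^{\infty}(-1)^j\beta_{\alpha,j-1}(x)\log\frac1{x_{\alpha,j}},$$ defined at those $x$ at which the sequence of partial sums of the series converges. A function $f:\mathbb R\to\mathbb R$ (defined almost everywhere) is in $\mathrm{BMO}$ if it is locally integrable and $$\sup_{a<b}\ \frac1{b-a}\int_a^b\left|f(x)-\frac1{b-a}\int_a^b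 f(y)\,dy\right|dx<\infty .$$ **Theorem.** For every $\alpha\in[1-g,g]$ the series defining $W_\alpha$ converges at almost every $x\in\mathbb R$, and $W_\alpha\in\mathrm{BMO}$. -/

import Mathlib

open MeasureTheory Filter Topology

noncomputable section

namespace Wilton

/-- The number `g = (√5 - 1) / 2`. -/
def g : ℝ := (Real.sqrt 5 - 1) / 2

/-- The (folded) Nakada map `A_α(x) = |1/x - [1/x + 1 - α]|` for `x ≠ 0`, with `A_α(0) = 0`. -/
def nakadaMap (α x : ℝ) : ℝ :=
  if x = 0 then 0 else |1 / x - (⌊1 / x + 1 - α⌋ : ℝ)|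

/-- The starting point `x_{α,0} = |x - [x + 1 - ᾱ]|`, where `ᾱ = max α (1 - α)`. -/
def startPoint (α x : ℝ) : ℝ := |x - (⌊x + 1 - max α (1 - α)⌋ : ℝ)|

/-- The orbit `x_{α,j} = A_α^j (x_{α,0})`. -/
def orbitPoint (α x : ℝ) (j : ℕ) : ℝ := (nakadaMap α)^[j] (startPoint α x)

/-- The product `x_{α,0} ⋯ x_{α,j-1}` of the first `j` points of the orbit,
that is, `β_{α,j-1}(x)`; for `j = 0` it is `β_{α,-1} = 1`. -/
def betaPrev (α x : ℝ) (j : ℕ) : ℝ := ∏ i ∈ Finset.range j, orbitPoint α x i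

/-- The `j`-th term `(-1)^j β_{α,j-1}(x) log (1 / x_{α,j})` of the Wilton series. -/
def wiltonTerm (α x : ℝ) (j : ℕ) : ℝ :=
  (-1) ^ j * betaPrev α x j * Real.log (1 / orbitPoint α x j)

/-- The sum of the first `N` terms of the Wilton series. -/
def wiltonPartialSum (α : ℝ) (N : ℕ) (x : ℝ) : ℝ := ∑ j ∈ Finset.range N, wiltonTerm α x j

/-- The Wilton series of `x` converges, i.e. its sequence of partial sums has a finite limit
(no absolute convergence is required). -/
def WiltonConverges (α x : ℝ) : Prop :=
  ∃ l : ℝ, Tendsto (fun N => wiltonPartialSum α N x) atTop (𝓝 l)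

/-- The Wilton function `W_α`: the limit of the partial sums of the Wilton series
(the value has no meaning where the series diverges). -/
def wiltonFunction (α x : ℝ) : ℝ := limUnder atTop (fun N => wiltonPartialSum α N x)

/-- `f` is a function of bounded mean oscillation on the real line: it is locally integrable and
its mean oscillations over all bounded intervals are bounded by one constant. -/
def MemBMO (f : ℝ → ℝ) : Prop :=
  LocallyIntegrable f volume ∧
    ∃ C : ℝ, ∀ a b : ℝ, a < b → (⨍ x in a..b, |f x - ⨍ y in a..b, f y|) ≤ C

end Wilton

end

noncomputable section

namespace Wilton

open scoped ENNReal

/-! ### The golden mean -/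

/-! The proof compares every `W_α` with a single function `F = evenWilton`, the Wilton function for
`α = 1/2`: the Neumann series `∑ (-1)^j T^j logDist` of `T = transfer`. All functions involved are
even and 1-periodic. Such a function takes the same value at `1/x` and at `|1/x - n|` for every
integer `n`, so it cannot see which `α` was used to fold the orbit.

Convergence. A positive operator `majorant`, which dominates `T` and also `f ↦ x f(1/x)` on `(0,
g]`, contracts `L¹` of a period by the factor `2(1/4 + g³) < 1` (`lintegral_majorant_le`,
`contraction_lt_one`). The dominating series is therefore integrable over a period and finite almost
everywhere (`ae_regular`).

Comparison. Put `D(x) = F(x) + log x + x F(1/x)` (`defect`). Substituting `log(1/x_j) = F(x_j) + x_j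
F(x_{j+1}) - D(x_j)` makes the Wilton partial sums telescope (`Regular.wiltonPartialSum_eq`). The
remainder is controlled by a tail of the dominating series. What is left is `W_α = F - ∑ (-1)^j
β_{j-1} D(x_j)`, and `β_{j-1} ≤ g^j`, so it suffices that `D` is bounded on `(0, g]`. There `D`
vanishes up to `1/2`, and beyond it satisfies a recursion along the map `x ↦ 1/(1-x) - 2`, which
expands away from its fixed point `g`, with factor `1 - x < 1/2` (`Regular.defect_eq`,
`Regular.abs_defect_le`).

Mean oscillation. The partial sums of `F` satisfy `F_{N+1} = logDist - T F_N`, and their oscillation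
is bounded uniformly in `N` by induction (`oscLe_evenPartialSum`). Near `0` the logarithm and the
`L¹` bound suffice; away from `0`, inversion carries the interval to one for `F_N` and halves the
constant. The bound then passes to `F`, and the bounded correction does no harm
(`oscLe_wiltonFunction`). -/

theorem g_sq : g ^ 2 = 1 - g := by
  unfold g
  nlinarith [Real.sq_sqrt (show (0 : ℝ) ≤ 5 by norm_num)]

theorem g_gt : 0.618 < g := by
  unfold g
  have : (2.236 : ℝ) < Real.sqrt 5 := Real.lt_sqrt_of_sq_lt (by norm_num)
  linarith

theorem g_lt : g < 0.6181 := by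
  unfold g
  have : Real.sqrt 5 < 2.2362 := by
    rw [Real.sqrt_lt' (by norm_num)]; norm_num
  linarith

theorem g_pos : 0 < g := by linarith [g_gt]

/-! ### Even periodic functions -/

/-- `f` is even and has period `1`. -/
structure EvenPeriodic {β : Type*} (f : ℝ → β) : Prop where
  periodic : Function.Periodic f 1
  even : ∀ x, f (-x) = f x

namespace EvenPeriodic

variable {β : Type*} {f : ℝ → β}

theorem sub_int (hf : EvenPeriodic f) (x : ℝ) (n : ℤ) : f (x - n) = f x := by
  simpa using hf.periodic.sub_zsmul_eq (x := x) n

theorem add_int (hf : EvenPeriodic f) (x : ℝ) (n : ℤ) : f (x + n) = f x := by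
  simpa using hf.sub_int x (-n)

theorem int_sub (hf : EvenPeriodic f) (n : ℤ) (x : ℝ) : f (n - x) = f x := by
  rw [← hf.even, neg_sub, hf.sub_int]

/-- This is what removes `α` from the problem: the starting point and every step of a Nakada orbit
have the form `|y - n|`. -/
theorem abs_sub_int (hf : EvenPeriodic f) (x : ℝ) (n : ℤ) : f |x - n| = f x := by
  rcases abs_choice (x - n) with h | h <;> rw [h]
  · exact hf.sub_int x n
  · rw [hf.even, hf.sub_int]

theorem comp {γ : Type*} (hf : EvenPeriodic f) (k : β → γ) : EvenPeriodic fun x => k (f x) :=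
  ⟨fun x => congrArg k (hf.periodic x), fun x => congrArg k (hf.even x)⟩

end EvenPeriodic

theorem setLIntegral_Ioc_add_one {f : ℝ → ℝ≥0∞} (hf : Function.Periodic f 1) (a b : ℝ) :
    ∫⁻ x in Set.Ioc a (a + 1), f x = ∫⁻ x in Set.Ioc b (b + 1), f x := by
  refine (isAddFundamentalDomain_Ioc one_pos a).setLIntegral_eq
    (isAddFundamentalDomain_Ioc one_pos b) f ?_
  rintro ⟨z, hz⟩ x
  obtain ⟨n, rfl⟩ := AddSubgroup.mem_zmultiples_iff.1 hz
  have : f (x + n • (1 : ℝ)) = f x := by simpa using hf.sub_zsmul_eq (x := x) (-n)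
  rw [← this, add_comm]
  rfl

theorem setLIntegral_Ioc_add_nat {f : ℝ → ℝ≥0∞} (hf : Function.Periodic f 1) (a : ℝ) (n : ℕ) :
    ∫⁻ x in Set.Ioc a (a + n), f x ≤ n * ∫⁻ x in Set.Ioc (0 : ℝ) 1, f x := by
  induction n with
  | zero => simp
  | succ n ih =>
    have h1 : Set.Ioc a (a + (n + 1 : ℕ)) = Set.Ioc a (a + n) ∪ Set.Ioc (a + n) (a + n + 1) := by
      rw [Set.Ioc_union_Ioc_eq_Ioc (by simp) (by simp)]
      push_cast; ring_nf
    rw [h1]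
    refine (lintegral_union_le _ _ _).trans ?_
    have h2 := setLIntegral_Ioc_add_one hf (a + n) 0
    rw [zero_add] at h2
    rw [h2]
    push_cast
    rw [add_mul, one_mul]
    gcongr

/-- The integral of a nonnegative periodic function over an interval. -/
theorem setLIntegral_Icc_le_of_periodic {f : ℝ → ℝ≥0∞} (hf : Function.Periodic f 1) {a b : ℝ}
    (hab : a ≤ b) :
    ∫⁻ x in Set.Icc a b, f x ≤ ENNReal.ofReal (b - a + 1) * ∫⁻ x in Set.Ioc (0 : ℝ) 1, f x := by
  rw [setLIntegral_congr Ioc_ae_eq_Icc.symm]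
  calc ∫⁻ x in Set.Ioc a b, f x ≤ ∫⁻ x in Set.Ioc a (a + ⌈b - a⌉₊), f x := by
        refine lintegral_mono_set (Set.Ioc_subset_Ioc_right ?_)
        linarith [Nat.le_ceil (b - a)]
    _ ≤ _ := setLIntegral_Ioc_add_nat hf _ _
    _ ≤ _ := by
        gcongr
        rw [← ENNReal.ofReal_natCast]
        exact ENNReal.ofReal_le_ofReal (Nat.ceil_lt_add_one (by linarith)).le

/-! ### The inversion `x ↦ 1 / x` -/

/-- Change of variables `y = 1/x`, whose Jacobian `1/x²` is at least `1/b²` on `[a, b]`. -/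
theorem setLIntegral_comp_inv_le {a b : ℝ} (ha : 0 < a) (hab : a ≤ b) (f : ℝ → ℝ≥0∞) :
    ∫⁻ x in Set.Icc a b, f (1 / x) ≤
      ENNReal.ofReal (b ^ 2) * ∫⁻ y in Set.Icc (1 / b) (1 / a), f y := by
  have hb : 0 < b := ha.trans_le hab
  have him : (fun x : ℝ => x⁻¹) '' Set.Icc a b = Set.Icc (1 / b) (1 / a) := by
    ext y
    simp only [Set.mem_image, Set.mem_Icc]
    constructor
    · rintro ⟨x, ⟨h1, h2⟩, rfl⟩
      have hx : 0 < x := ha.trans_le h1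
      rw [← one_div]
      exact ⟨one_div_le_one_div_of_le hx h2, one_div_le_one_div_of_le ha h1⟩
    · rintro ⟨h1, h2⟩
      have hy : 0 < y := (one_div_pos.2 hb).trans_le h1
      refine ⟨y⁻¹, ⟨?_, ?_⟩, inv_inv y⟩
      · rw [← one_div]; exact (le_one_div hy ha).1 h2
      · rw [← one_div]; exact (one_div_le hb hy).1 h1
  rw [← him, lintegral_image_eq_lintegral_abs_deriv_mul measurableSet_Icc
    (f' := fun x => -(x ^ 2)⁻¹)
    (fun x hx => (hasDerivAt_inv (ha.trans_le hx.1).ne').hasDerivWithinAt)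
    (fun x _ y _ h => inv_injective h), ← lintegral_const_mul' _ _ ENNReal.ofReal_ne_top]
  refine setLIntegral_mono' measurableSet_Icc fun x hx => ?_
  have hx0 : 0 < x := ha.trans_le hx.1
  rw [← mul_assoc, ← ENNReal.ofReal_mul (by positivity), one_div]
  refine le_mul_of_one_le_left zero_le ?_
  rw [ENNReal.one_le_ofReal, abs_neg, abs_of_pos (by positivity), ← div_eq_mul_inv,
    one_le_div (by positivity)]
  exact pow_le_pow_left₀ hx0.le hx.2 2

/-- On this interval `1/x` sweeps exactly one period. -/
theorem setLIntegral_comp_inv_le_of_periodic {f : ℝ → ℝ≥0∞} (hf : Function.Periodic f 1)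
    {n : ℕ} (hn : 0 < n) :
    ∫⁻ x in Set.Icc (1 / (n + 1 : ℝ)) (1 / (n : ℝ)), f (1 / x) ≤
      ENNReal.ofReal (1 / (n : ℝ) ^ 2) * ∫⁻ x in Set.Ioc (0 : ℝ) 1, f x := by
  have hn' : (0 : ℝ) < n := by exact_mod_cast hn
  refine (setLIntegral_comp_inv_le (by positivity)
    (one_div_le_one_div_of_le hn' (by linarith)) f).trans ?_
  rw [one_div_one_div, one_div_one_div, ← setLIntegral_congr Ioc_ae_eq_Icc,
    setLIntegral_Ioc_add_one hf n 0, zero_add, one_div_pow]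

theorem Ioc_half_subset_iUnion :
    Set.Ioc (0 : ℝ) (1 / 2) ⊆
      ⋃ n : ℕ, Set.Icc (1 / ((n + 2 : ℕ) + 1 : ℝ)) (1 / ((n + 2 : ℕ) : ℝ)) := by
  rintro x ⟨h1, h2⟩
  have h3 : 2 ≤ ⌊1 / x⌋₊ := Nat.le_floor ((le_div_iff₀ h1).2 (by push_cast; linarith))
  obtain ⟨n, hn⟩ := Nat.exists_eq_add_of_le' h3
  refine Set.mem_iUnion.2 ⟨n, ?_, ?_⟩
  · rw [one_div_le (by positivity) h1, ← hn]
    exact (Nat.lt_floor_add_one _).le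
  · rw [le_one_div h1 (by positivity), ← hn]
    exact Nat.floor_le (by positivity)

theorem sum_one_div_sq_le (N : ℕ) :
    ∑ i ∈ Finset.range N, 1 / ((i + 2 : ℕ) : ℝ) ^ 2 ≤ 1 - 1 / (N + 1 : ℝ) := by
  induction N with
  | zero => simp
  | succ n ih =>
    rw [Finset.sum_range_succ]
    have h : 1 / ((n + 2 : ℕ) : ℝ) ^ 2 ≤ 1 / (n + 1 : ℝ) -1 / ((n + 1 : ℕ) + 1 : ℝ) := by
      push_cast
      rw [div_sub_div _ _ (by positivity) (by positivity), div_le_div_iff₀ (by positivity)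
        (by positivity)]
      have : (0 : ℝ) ≤ n := n.cast_nonneg
      nlinarith
    linarith

/-- Telescoping, from `1/m³ ≤ 1/((m-1)m(m+1))`. The value `1/4` is sharp enough to keep
`contraction` below `1`. -/
theorem sum_one_div_cube_le (N : ℕ) :
    ∑ i ∈ Finset.range N, 1 / ((i + 2 : ℕ) : ℝ) ^ 3 ≤ 1 / 4 - 1 / (2 * (N + 1) * (N + 2) : ℝ) := by
  induction N with
  | zero => norm_num
  | succ n ih =>
    rw [Finset.sum_range_succ]
    have h : 1 / ((n + 2 : ℕ) : ℝ) ^ 3 ≤ 1 / (2 * (n + 1) * (n + 2) : ℝ) -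
        1 / (2 * ((n + 1 : ℕ) + 1) * ((n + 1 : ℕ) + 2) : ℝ) := by
      have h0 : (0 : ℝ) ≤ n := n.cast_nonneg
      have : 1 / (2 * (n + 1) * (n + 2) : ℝ) - 1 / (2 * ((n + 1 : ℕ) + 1) * ((n + 1 : ℕ) + 2) : ℝ)
          = 1 / ((n + 1) * (n + 2) * (n + 3)) := by
        push_cast
        field_simp
        ring
      rw [this]
      push_cast
      refine one_div_le_one_div_of_le (by positivity) ?_
      nlinarith
    linarith

theorem tsum_ofReal_le {f : ℕ → ℝ} (hf : ∀ n, 0 ≤ f n) {c : ℝ}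
    (h : ∀ N, ∑ i ∈ Finset.range N, f i ≤ c) : ∑' n, ENNReal.ofReal (f n) ≤ ENNReal.ofReal c := by
  refine ENNReal.tsum_le_of_sum_range_le fun n => ?_
  rw [← ENNReal.ofReal_sum_of_nonneg fun i _ => hf i]
  exact ENNReal.ofReal_le_ofReal (h n)

theorem setLIntegral_comp_inv_half_le {f : ℝ → ℝ≥0∞} (hf : Function.Periodic f 1) :
    ∫⁻ x in Set.Ioc (0 : ℝ) (1 / 2), f (1 / x) ≤ ∫⁻ x in Set.Ioc (0 : ℝ) 1, f x := by
  calc _ ≤ _ := lintegral_mono_set Ioc_half_subset_iUnion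
    _ ≤ _ := lintegral_iUnion_le _ _
    _ ≤ ∑' n : ℕ, ENNReal.ofReal (1 / ((n + 2 : ℕ) : ℝ) ^ 2) * ∫⁻ x in Set.Ioc (0 : ℝ) 1, f x :=
        ENNReal.tsum_le_tsum fun n => setLIntegral_comp_inv_le_of_periodic hf (by omega)
    _ ≤ ENNReal.ofReal 1 * ∫⁻ x in Set.Ioc (0 : ℝ) 1, f x := by
        rw [ENNReal.tsum_mul_right]
        gcongr
        refine tsum_ofReal_le (fun n => by positivity) fun N => ?_
        have : (0 : ℝ) ≤ 1 / (N + 1) := by positivity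
        linarith [sum_one_div_sq_le N]
    _ = _ := by simp

theorem setLIntegral_mul_comp_inv_half_le {f : ℝ → ℝ≥0∞} (hf : Function.Periodic f 1) :
    ∫⁻ x in Set.Ioc (0 : ℝ) (1 / 2), ENNReal.ofReal x * f (1 / x) ≤
      ENNReal.ofReal (1 / 4) * ∫⁻ x in Set.Ioc (0 : ℝ) 1, f x := by
  calc _ ≤ _ := lintegral_mono_set Ioc_half_subset_iUnion
    _ ≤ _ := lintegral_iUnion_le _ _
    _ ≤ ∑' n : ℕ, ENNReal.ofReal (1 / ((n + 2 : ℕ) : ℝ) ^ 3) *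
          ∫⁻ x in Set.Ioc (0 : ℝ) 1, f x := by
        refine ENNReal.tsum_le_tsum fun n => ?_
        have h1 : 1 / ((n + 2 : ℕ) : ℝ) ^ 3 = 1 / ((n + 2 : ℕ) : ℝ) * (1 / ((n + 2 : ℕ) : ℝ) ^ 2) := by
          field_simp
        rw [h1, ENNReal.ofReal_mul (by positivity), mul_assoc]
        refine le_trans ?_ (mul_le_mul_right
          (setLIntegral_comp_inv_le_of_periodic hf (n := n + 2) (by omega)) _)
        rw [← lintegral_const_mul' _ _ ENNReal.ofReal_ne_top]
        refine setLIntegral_mono' measurableSet_Icc fun x hx => ?_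
        gcongr
        exact hx.2
    _ ≤ _ := by
        rw [ENNReal.tsum_mul_right]
        gcongr
        refine tsum_ofReal_le (fun n => by positivity) fun N => ?_
        have : (0 : ℝ) ≤ 1 / (2 * (N + 1) * (N + 2)) := by positivity
        linarith [sum_one_div_cube_le N]

/-- On `[1/2, g]` the weight gives `g` and the Jacobian `g²`, while `1/x` stays in `(1, 2]`, within
one period. -/
theorem setLIntegral_mul_comp_inv_g_le {f : ℝ → ℝ≥0∞} (hf : Function.Periodic f 1) :
    ∫⁻ x in Set.Ioc (0 : ℝ) g, ENNReal.ofReal x * f (1 / x) ≤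
      ENNReal.ofReal (1 / 4 + g ^ 3) * ∫⁻ x in Set.Ioc (0 : ℝ) 1, f x := by
  have hg := g_gt
  have hg0 := g_pos
  have hg1 := g_lt
  have h1 : Set.Ioc (0 : ℝ) g ⊆ Set.Ioc 0 (1 / 2) ∪ Set.Icc (1 / 2) g := by
    intro x hx
    rcases le_total x (1 / 2) with h | h
    · exact Or.inl ⟨hx.1, h⟩
    · exact Or.inr ⟨h, hx.2⟩
  rw [ENNReal.ofReal_add (by norm_num) (by positivity), add_mul]
  refine (lintegral_mono_set h1).trans ((lintegral_union_le _ _ _).trans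
    (add_le_add (setLIntegral_mul_comp_inv_half_le hf) ?_))
  have h2 : g ^ 3 = g * g ^ 2 := by ring
  rw [h2, ENNReal.ofReal_mul hg0.le, mul_assoc]
  have h3 : ∫⁻ y in Set.Icc (1 / g) (1 / (1 / 2)), f y ≤ ∫⁻ x in Set.Ioc (0 : ℝ) 1, f x := by
    have := setLIntegral_Ioc_add_one hf 1 0
    rw [zero_add] at this
    rw [← this]
    refine lintegral_mono_set fun x hx => ⟨?_, ?_⟩
    · refine lt_of_lt_of_le ?_ hx.1
      rw [lt_div_iff₀ hg0]; linarith
    · linarith [hx.2]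
  refine le_trans ?_ (mul_le_mul_right (mul_le_mul_right h3 _) _)
  refine le_trans ?_ (mul_le_mul_right (setLIntegral_comp_inv_le (a := 1 / 2) (b := g)
    (by norm_num) (by linarith) f) _)
  rw [← lintegral_const_mul' _ _ ENNReal.ofReal_ne_top]
  refine setLIntegral_mono' measurableSet_Icc fun x hx => ?_
  gcongr
  exact hx.2

/-! ### The distance to the nearest integer -/

/-- The distance from `x` to the nearest integer. -/
def nearDist (x : ℝ) : ℝ := |x - round x|

theorem nearDist_eq_min (x : ℝ) : nearDist x = min (Int.fract x) (1 - Int.fract x) :=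
  abs_sub_round_eq_min x

theorem nearDist_nonneg (x : ℝ) : 0 ≤ nearDist x := abs_nonneg _

theorem nearDist_le_half (x : ℝ) : nearDist x ≤ 1 / 2 := abs_sub_round x

theorem nearDist_eq_fract_or (x : ℝ) :
    nearDist x = Int.fract x ∨ nearDist x = 1 - Int.fract x := by
  rw [nearDist_eq_min]
  exact min_choice _ _

theorem evenPeriodic_nearDist : EvenPeriodic nearDist where
  periodic x := by simp [nearDist_eq_min]
  even x := by
    simp only [nearDist_eq_min]
    by_cases h : Int.fract x = 0
    · rw [h, Int.fract_neg_eq_zero.2 h]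
    · rw [Int.fract_neg h, min_comm]; simp

theorem nearDist_of_mem {x : ℝ} (h0 : 0 ≤ x) (h1 : x ≤ 1 / 2) : nearDist x = x := by
  rw [nearDist_eq_min, Int.fract_eq_self.2 ⟨h0, by linarith⟩, min_eq_left (by linarith)]

theorem measurable_nearDist : Measurable nearDist := by
  have : nearDist = fun x => min (Int.fract x) (1 - Int.fract x) := funext nearDist_eq_min
  rw [this]
  exact measurable_fract.min (measurable_const.sub measurable_fract)

/-- The even periodic function equal to `log (1 / x)` on `(0, 1/2]`. -/
def logDist (x : ℝ) : ℝ := Real.log (1 / nearDist x)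

theorem evenPeriodic_logDist : EvenPeriodic logDist :=
  evenPeriodic_nearDist.comp fun t => Real.log (1 / t)

theorem measurable_logDist : Measurable logDist :=
  Real.measurable_log.comp (measurable_nearDist.const_div 1)

theorem logDist_nonneg (x : ℝ) : 0 ≤ logDist x := by
  unfold logDist
  rcases (nearDist_nonneg x).eq_or_lt with h | h
  · simp [← h]
  · refine Real.log_nonneg ?_
    rw [le_div_iff₀ h]
    linarith [nearDist_le_half x]

/-! ### The signed transfer operator -/

/-- The operator `f ↦ x f(1/x)` on `(0, 1/2]`, extended to be even and periodic. -/
def transfer (f : ℝ → ℝ) (x : ℝ) : ℝ := nearDist x * f (1 / nearDist x)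

theorem evenPeriodic_transfer (f : ℝ → ℝ) : EvenPeriodic (transfer f) :=
  evenPeriodic_nearDist.comp fun t => t * f (1 / t)

theorem measurable_transfer {f : ℝ → ℝ} (hf : Measurable f) : Measurable (transfer f) :=
  measurable_nearDist.mul (hf.comp (measurable_nearDist.const_div 1))

/-- The iterates of the transfer operator on `logDist`. -/
def transferIter (j : ℕ) : ℝ → ℝ := transfer^[j] logDist

theorem transferIter_succ (j : ℕ) : transferIter (j + 1) = transfer (transferIter j) :=
  Function.iterate_succ_apply' _ _ _

theorem evenPeriodic_transferIter (j : ℕ) : EvenPeriodic (transferIter j) := by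
  cases j with
  | zero => exact evenPeriodic_logDist
  | succ j => rw [transferIter_succ]; exact evenPeriodic_transfer _

theorem measurable_transferIter (j : ℕ) : Measurable (transferIter j) := by
  induction j with
  | zero => exact measurable_logDist
  | succ j ih => rw [transferIter_succ]; exact measurable_transfer ih

/-! ### The dominating operator -/

/-- `t f(1/t)` cut off to `(0, g]`. -/
def cutTransfer (f : ℝ → ℝ≥0∞) : ℝ → ℝ≥0∞ :=
  Set.indicator (Set.Ioc 0 g) fun t => ENNReal.ofReal t * f (1 / t)

/-- A positive operator dominating all the maps `f ↦ x f(A_α x)`, `α ∈ [1 - g, g]`. -/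
def majorant (f : ℝ → ℝ≥0∞) (x : ℝ) : ℝ≥0∞ :=
  cutTransfer f (Int.fract x) + cutTransfer f (1 - Int.fract x)

theorem measurable_cutTransfer {f : ℝ → ℝ≥0∞} (hf : Measurable f) : Measurable (cutTransfer f) :=
  (ENNReal.measurable_ofReal.mul (hf.comp (measurable_id.const_div 1))).indicator
    measurableSet_Ioc

theorem measurable_majorant {f : ℝ → ℝ≥0∞} (hf : Measurable f) : Measurable (majorant f) :=
  ((measurable_cutTransfer hf).comp measurable_fract).add
    ((measurable_cutTransfer hf).comp (measurable_const.sub measurable_fract))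

theorem evenPeriodic_majorant (f : ℝ → ℝ≥0∞) : EvenPeriodic (majorant f) where
  periodic x := by simp [majorant]
  even x := by
    unfold majorant
    by_cases h : Int.fract x = 0
    · rw [h, Int.fract_neg_eq_zero.2 h]
    · rw [Int.fract_neg h, add_comm]; simp

theorem cutTransfer_of_mem {f : ℝ → ℝ≥0∞} {t : ℝ} (h0 : 0 < t) (h1 : t ≤ g) :
    cutTransfer f t = ENNReal.ofReal t * f (1 / t) :=
  Set.indicator_of_mem (show t ∈ Set.Ioc 0 g from ⟨h0, h1⟩) _

theorem le_majorant (f : ℝ → ℝ≥0∞) {x : ℝ} (h0 : 0 < x) (h1 : x ≤ g) :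
    ENNReal.ofReal x * f (1 / x) ≤ majorant f x := by
  unfold majorant
  rw [Int.fract_eq_self.2 ⟨h0.le, by linarith [g_lt]⟩, cutTransfer_of_mem h0 h1]
  exact le_self_add

theorem ofReal_abs_transfer_le {f : ℝ → ℝ} {F : ℝ → ℝ≥0∞} (h : ∀ x, ENNReal.ofReal |f x| ≤ F x)
    (x : ℝ) : ENNReal.ofReal |transfer f x| ≤ majorant F x := by
  unfold transfer
  rcases (nearDist_nonneg x).eq_or_lt with hd | hd
  · simp [← hd]
  · rw [abs_mul, abs_of_pos hd, ENNReal.ofReal_mul hd.le]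
    refine (mul_le_mul_right (h _) _).trans ?_
    have hg : nearDist x ≤ g := (nearDist_le_half x).trans (by linarith [g_gt])
    rw [← cutTransfer_of_mem hd hg]
    unfold majorant
    rcases nearDist_eq_fract_or x with h' | h' <;> rw [h']
    · exact le_self_add
    · exact le_add_self

theorem majorant_tsum (f : ℕ → ℝ → ℝ≥0∞) (x : ℝ) :
    majorant (fun y => ∑' j, f j y) x = ∑' j, majorant (f j) x := by
  have h (t : ℝ) : cutTransfer (fun y => ∑' j, f j y) t = ∑' j, cutTransfer (f j) t := by
    unfold cutTransfer
    by_cases ht : t ∈ Set.Ioc 0 g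
    · simp only [Set.indicator_of_mem ht, ENNReal.tsum_mul_left]
    · simp only [Set.indicator_of_notMem ht, tsum_zero]
  simp only [majorant, h, ENNReal.tsum_add]

/-- The contraction factor of the operator `majorant` on periodic functions. -/
def contraction : ℝ := 2 * (1 / 4 + g ^ 3)

/-- Since `g³ = 2g - 1`, the factor equals `4g - 3/2`, roughly `0.972`. -/
theorem contraction_lt_one : contraction < 1 := by
  have h : g ^ 3 = 2 * g - 1 := by linear_combination (g - 1) * g_sq
  unfold contraction
  rw [h]
  linarith [g_lt]

/-- The factor `2` in `contraction` comes from the two branches `x` and `1 - x`, which contribute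
equally by reflection. -/
theorem lintegral_majorant_le {f : ℝ → ℝ≥0∞} (hf : Function.Periodic f 1) (hm : Measurable f) :
    ∫⁻ x in Set.Ioc (0 : ℝ) 1, majorant f x ≤
      ENNReal.ofReal contraction * ∫⁻ x in Set.Ioc (0 : ℝ) 1, f x := by
  have hc : ∫⁻ x, cutTransfer f x ≤
      ENNReal.ofReal (1 / 4 + g ^ 3) * ∫⁻ x in Set.Ioc (0 : ℝ) 1, f x := by
    unfold cutTransfer
    rw [lintegral_indicator measurableSet_Ioc]
    exact setLIntegral_mul_comp_inv_g_le hf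
  rw [setLIntegral_congr Ioo_ae_eq_Ioc.symm]
  calc ∫⁻ x in Set.Ioo (0 : ℝ) 1, majorant f x
      = ∫⁻ x in Set.Ioo (0 : ℝ) 1, (cutTransfer f x + cutTransfer f (1 - x)) := by
        refine setLIntegral_congr_fun measurableSet_Ioo fun x hx => ?_
        simp only [majorant, Int.fract_eq_self.2 ⟨hx.1.le, hx.2⟩]
    _ ≤ ∫⁻ x, (cutTransfer f x + cutTransfer f (1 - x)) := setLIntegral_le_lintegral _ _
    _ = 2 * ∫⁻ x, cutTransfer f x := by
        rw [lintegral_add_left (measurable_cutTransfer hm),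
          lintegral_sub_left_eq_self (cutTransfer f) 1, two_mul]
    _ ≤ 2 * (ENNReal.ofReal (1 / 4 + g ^ 3) * ∫⁻ x in Set.Ioc (0 : ℝ) 1, f x) := by gcongr
    _ = _ := by
        rw [contraction, ENNReal.ofReal_mul (by norm_num), mul_assoc]
        simp

/-! ### Integrability and tails of the dominating series -/

/-- The iterates of the dominating operator on `logDist`. -/
def majorantIter (j : ℕ) : ℝ → ℝ≥0∞ := majorant^[j] fun x => ENNReal.ofReal (logDist x)

theorem majorantIter_succ (j : ℕ) : majorantIter (j + 1) = majorant (majorantIter j) :=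
  Function.iterate_succ_apply' _ _ _

theorem evenPeriodic_majorantIter (j : ℕ) : EvenPeriodic (majorantIter j) := by
  cases j with
  | zero => exact evenPeriodic_logDist.comp ENNReal.ofReal
  | succ j => rw [majorantIter_succ]; exact evenPeriodic_majorant _

theorem measurable_majorantIter (j : ℕ) : Measurable (majorantIter j) := by
  induction j with
  | zero => exact measurable_logDist.ennreal_ofReal
  | succ j ih => rw [majorantIter_succ]; exact measurable_majorant ih

theorem ofReal_abs_transferIter_le (j : ℕ) (x : ℝ) :
    ENNReal.ofReal |transferIter j x| ≤ majorantIter j x := by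
  induction j generalizing x with
  | zero => exact (congrArg _ (abs_of_nonneg (logDist_nonneg x))).le
  | succ j ih =>
    rw [transferIter_succ, majorantIter_succ]
    exact ofReal_abs_transfer_le ih x

theorem lintegral_logDist_lt_top :
    ∫⁻ x in Set.Ioc (0 : ℝ) 1, ENNReal.ofReal (logDist x) < ∞ := by
  have h1 : IntegrableOn (fun x => -Real.log x) (Set.Ioc (0 : ℝ) 1) :=
    ((intervalIntegrable_iff_integrableOn_Ioc_of_le zero_le_one).1
      intervalIntegral.intervalIntegrable_log').neg
  have h2 : IntegrableOn (fun x => -Real.log (1 - x)) (Set.Ioc (0 : ℝ) 1) := by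
    have := (intervalIntegral.intervalIntegrable_log' (a := 1) (b := 0)).comp_sub_left 1
    simp only [sub_self, sub_zero] at this
    exact ((intervalIntegrable_iff_integrableOn_Ioc_of_le zero_le_one).1 this).neg
  refine lt_of_le_of_lt ?_ (h1.add h2).lintegral_lt_top
  rw [setLIntegral_congr Ioo_ae_eq_Ioc.symm, setLIntegral_congr Ioo_ae_eq_Ioc.symm]
  -- The distance is `x` or `1 - x`, so `-log x - log (1 - x)` dominates.
  refine setLIntegral_mono' measurableSet_Ioo fun x hx => ENNReal.ofReal_le_ofReal ?_
  have hf : Int.fract x = x := Int.fract_eq_self.2 ⟨hx.1.le, hx.2⟩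
  have ha : Real.log x ≤ 0 := Real.log_nonpos hx.1.le hx.2.le
  have hb : Real.log (1 - x) ≤ 0 := Real.log_nonpos (by linarith [hx.2]) (by linarith [hx.1])
  simp only [logDist, one_div, Real.log_inv, Pi.add_apply]
  rcases nearDist_eq_fract_or x with h | h <;> rw [h, hf] <;> linarith

theorem lintegral_majorantIter_le (j : ℕ) :
    ∫⁻ x in Set.Ioc (0 : ℝ) 1, majorantIter j x ≤
      ENNReal.ofReal contraction ^ j *
        ∫⁻ x in Set.Ioc (0 : ℝ) 1, ENNReal.ofReal (logDist x) := by
  induction j with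
  | zero => simp [majorantIter]
  | succ j ih =>
    rw [majorantIter_succ]
    refine (lintegral_majorant_le (evenPeriodic_majorantIter j).periodic
      (measurable_majorantIter j)).trans ?_
    rw [pow_succ', mul_assoc]
    gcongr

theorem tsum_lintegral_majorantIter_ne_top :
    ∑' j, ∫⁻ x in Set.Ioc (0 : ℝ) 1, majorantIter j x ≠ ∞ := by
  refine ne_top_of_le_ne_top ?_ (ENNReal.tsum_le_tsum lintegral_majorantIter_le)
  rw [ENNReal.tsum_mul_right, ENNReal.tsum_geometric]
  refine ENNReal.mul_ne_top (ENNReal.inv_ne_top.2 ?_) lintegral_logDist_lt_top.ne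
  refine (tsub_pos_of_lt ?_).ne'
  exact ENNReal.ofReal_lt_one.2 contraction_lt_one

/-- The sum of the terms `majorantIter j` with `j ≥ N`. -/
def majorantTail (N : ℕ) (x : ℝ) : ℝ≥0∞ := ∑' j, majorantIter (j + N) x

theorem evenPeriodic_majorantTail (N : ℕ) : EvenPeriodic (majorantTail N) where
  periodic x := tsum_congr fun _ => (evenPeriodic_majorantIter _).periodic x
  even x := tsum_congr fun _ => (evenPeriodic_majorantIter _).even x

theorem majorant_majorantTail (N : ℕ) (x : ℝ) :
    majorant (majorantTail N) x = majorantTail (N + 1) x := by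
  unfold majorantTail
  rw [majorant_tsum]
  refine tsum_congr fun j => ?_
  rw [← majorantIter_succ]
  rfl

theorem majorantTail_succ_le (N : ℕ) (x : ℝ) : majorantTail (N + 1) x ≤ majorantTail N x := by
  have h : ∀ j, majorantIter (j + (N + 1)) x = majorantIter ((j + 1) + N) x := fun j => by
    congr 1; omega
  unfold majorantTail
  simp only [h]
  exact ENNReal.tsum_comp_le_tsum_of_injective (add_left_injective 1)
    fun j => majorantIter (j + N) x

theorem lintegral_majorantTail (N : ℕ) :
    ∫⁻ x in Set.Ioc (0 : ℝ) 1, majorantTail N x =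
      ∑' j, ∫⁻ x in Set.Ioc (0 : ℝ) 1, majorantIter (j + N) x :=
  lintegral_tsum fun _ => (measurable_majorantIter _).aemeasurable

theorem tendsto_lintegral_majorantTail :
    Tendsto (fun N => ∫⁻ x in Set.Ioc (0 : ℝ) 1, majorantTail N x) atTop (𝓝 0) := by
  simp only [lintegral_majorantTail]
  exact ENNReal.tendsto_sum_nat_add _ tsum_lintegral_majorantIter_ne_top

theorem lintegral_majorantTail_zero_ne_top :
    ∫⁻ x in Set.Ioc (0 : ℝ) 1, majorantTail 0 x ≠ ∞ := by
  rw [lintegral_majorantTail]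
  exact tsum_lintegral_majorantIter_ne_top

theorem measurable_majorantTail (N : ℕ) : Measurable (majorantTail N) :=
  Measurable.tsum fun _ => measurable_majorantIter _

/-! ### The even Wilton function -/

/-- An irrational point at which the dominating series converges. -/
structure Regular (x : ℝ) : Prop where
  irrational : Irrational x
  ne_top : majorantTail 0 x ≠ ∞

namespace Regular

variable {x : ℝ}

theorem abs_sub_int (hx : Regular x) (n : ℤ) : Regular |x - n| where
  irrational := by
    rcases abs_choice (x - n) with h | h <;> rw [h]
    · exact hx.irrational.sub_intCast n
    · exact (hx.irrational.sub_intCast n).neg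
  ne_top := by rw [(evenPeriodic_majorantTail 0).abs_sub_int]; exact hx.ne_top

theorem sub_int (hx : Regular x) (n : ℤ) : Regular (x - n) :=
  ⟨hx.irrational.sub_intCast n, by
    rw [(evenPeriodic_majorantTail 0).sub_int]; exact hx.ne_top⟩

theorem int_sub (hx : Regular x) (n : ℤ) : Regular (n - x) :=
  ⟨hx.irrational.intCast_sub n, by
    rw [(evenPeriodic_majorantTail 0).int_sub]; exact hx.ne_top⟩

theorem majorantTail_ne_top (hx : Regular x) (N : ℕ) : majorantTail N x ≠ ∞ := by
  induction N with
  | zero => exact hx.ne_top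
  | succ N ih => exact ne_top_of_le_ne_top ih (majorantTail_succ_le N x)

/-- Finiteness passes to `1/x` because `x` times the full series at `1/x` is at most the tail from
index `1` at `x`. Hence whole orbits stay regular. -/
theorem one_div_of_le (hx : Regular x) (h0 : 0 < x) (h1 : x ≤ g) : Regular (1 / x) where
  irrational := by rw [one_div]; exact hx.irrational.inv
  ne_top := by
    have h := (le_majorant (majorantTail 0) h0 h1).trans (majorant_majorantTail 0 x).le
    intro htop
    rw [htop, ENNReal.mul_top (ENNReal.ofReal_pos.2 h0).ne', top_le_iff] at h
    exact hx.majorantTail_ne_top 1 h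

theorem majorantIter_ne_top (hx : Regular x) (j : ℕ) : majorantIter j x ≠ ∞ :=
  ne_top_of_le_ne_top hx.ne_top (ENNReal.le_tsum (f := fun j => majorantIter (j + 0) x) j)

theorem abs_transferIter_le (hx : Regular x) (j : ℕ) :
    |transferIter j x| ≤ (majorantIter j x).toReal :=
  (ENNReal.ofReal_le_iff_le_toReal (hx.majorantIter_ne_top j)).1 (ofReal_abs_transferIter_le j x)

theorem summable_toReal (hx : Regular x) (N : ℕ) :
    Summable fun j => (majorantIter (j + N) x).toReal :=
  ENNReal.summable_toReal (hx.majorantTail_ne_top N)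

theorem summable (hx : Regular x) : Summable fun j => (-1) ^ j * transferIter j x := by
  refine Summable.of_norm_bounded (hx.summable_toReal 0) fun j => ?_
  simpa using hx.abs_transferIter_le j

end Regular

theorem ae_regular : ∀ᵐ x : ℝ, Regular x := by
  have hlt : ∀ᵐ x ∂volume.restrict (Set.Ioc (0 : ℝ) 1), majorantTail 0 x < ∞ :=
    ae_lt_top (measurable_majorantTail 0) lintegral_majorantTail_zero_ne_top
  rw [ae_restrict_iff' measurableSet_Ioc] at hlt
  have hall : ∀ᵐ x : ℝ, ∀ n : ℤ, x - n ∈ Set.Ioc (0 : ℝ) 1 → majorantTail 0 (x - n) < ∞ := by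
    rw [ae_all_iff]
    intro n
    exact (measurePreserving_sub_right volume (n : ℝ)).quasiMeasurePreserving.ae hlt
  have hirr : ∀ᵐ x : ℝ, Irrational x := by
    have : (Set.range ((↑) : ℚ → ℝ)).Countable := Set.countable_range _
    exact this.ae_notMem volume
  filter_upwards [hall, hirr] with x h1 h2
  refine ⟨h2, ?_⟩
  have h3 := h1 ⌊x⌋ ⟨Int.fract_pos.2 (h2.ne_int _), (Int.fract_lt_one x).le⟩
  rw [(evenPeriodic_majorantTail 0).sub_int] at h3
  exact h3.ne

/-- The partial sums of the series of `evenWilton`. -/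
def evenPartialSum (N : ℕ) (x : ℝ) : ℝ := ∑ j ∈ Finset.range N, (-1) ^ j * transferIter j x

/-- The Wilton function of the nearest integer continued fraction, `α = 1/2`, defined as the
Neumann series of the operator `transfer`. -/
def evenWilton (x : ℝ) : ℝ := ∑' j, (-1) ^ j * transferIter j x

theorem evenPeriodic_evenWilton : EvenPeriodic evenWilton where
  periodic x := tsum_congr fun j => by rw [(evenPeriodic_transferIter j).periodic]
  even x := tsum_congr fun j => by rw [(evenPeriodic_transferIter j).even]

theorem evenPeriodic_evenPartialSum (N : ℕ) : EvenPeriodic (evenPartialSum N) where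
  periodic x := Finset.sum_congr rfl fun j _ => by rw [(evenPeriodic_transferIter j).periodic]
  even x := Finset.sum_congr rfl fun j _ => by rw [(evenPeriodic_transferIter j).even]

theorem measurable_evenPartialSum (N : ℕ) : Measurable (evenPartialSum N) :=
  Finset.measurable_fun_sum _ fun j _ => (measurable_transferIter j).const_mul _

theorem transferIter_succ_apply (j : ℕ) (x : ℝ) :
    transferIter (j + 1) x = nearDist x * transferIter j (1 / nearDist x) := by
  rw [transferIter_succ, transfer]

theorem evenPartialSum_succ (N : ℕ) (x : ℝ) :
    evenPartialSum (N + 1) x = logDist x - transfer (evenPartialSum N) x := by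
  unfold evenPartialSum transfer
  rw [Finset.sum_range_succ', Finset.mul_sum, sub_eq_neg_add, ← Finset.sum_neg_distrib]
  congr 1
  · refine Finset.sum_congr rfl fun j _ => ?_
    rw [transferIter_succ_apply]
    ring
  · simp [transferIter]

theorem ofReal_abs_evenPartialSum_le (N : ℕ) (x : ℝ) :
    ENNReal.ofReal |evenPartialSum N x| ≤ majorantTail 0 x := by
  calc ENNReal.ofReal |evenPartialSum N x|
      ≤ ENNReal.ofReal (∑ j ∈ Finset.range N, |transferIter j x|) := by
        refine ENNReal.ofReal_le_ofReal ((Finset.abs_sum_le_sum_abs _ _).trans_eq ?_)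
        simp [abs_mul]
    _ = ∑ j ∈ Finset.range N, ENNReal.ofReal |transferIter j x| :=
        ENNReal.ofReal_sum_of_nonneg fun _ _ => abs_nonneg _
    _ ≤ ∑ j ∈ Finset.range N, majorantIter j x :=
        Finset.sum_le_sum fun j _ => ofReal_abs_transferIter_le j x
    _ ≤ _ := ENNReal.sum_le_tsum (f := fun j => majorantIter j x) _

theorem Regular.evenWilton_eq {x : ℝ} (hx : Regular x) :
    evenWilton x = logDist x - nearDist x * evenWilton (1 / nearDist x) := by
  unfold evenWilton
  rw [hx.summable.tsum_eq_zero_add, ← tsum_mul_left, sub_eq_add_neg, ← tsum_neg]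
  congr 1
  · simp [transferIter]
  · refine tsum_congr fun j => ?_
    rw [transferIter_succ_apply]
    ring

theorem Regular.abs_evenWilton_sub_le {x : ℝ} (hx : Regular x) (N : ℕ) :
    ENNReal.ofReal |evenWilton x - evenPartialSum N x| ≤ majorantTail N x := by
  rw [ENNReal.ofReal_le_iff_le_toReal (hx.majorantTail_ne_top N)]
  have h := hx.summable.sum_add_tsum_nat_add N
  have h2 : evenWilton x - evenPartialSum N x =
      ∑' j, (-1) ^ (j + N) * transferIter (j + N) x := by
    unfold evenWilton evenPartialSum
    rw [← h]; ring
  rw [h2, majorantTail, ENNReal.tsum_toReal_eq fun j => hx.majorantIter_ne_top _]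
  rw [← Real.norm_eq_abs]
  refine tsum_of_norm_bounded (hx.summable_toReal N).hasSum fun j => ?_
  simpa using hx.abs_transferIter_le (j + N)

theorem Regular.abs_evenWilton_le {x : ℝ} (hx : Regular x) :
    ENNReal.ofReal |evenWilton x| ≤ majorantTail 0 x := by
  simpa [evenPartialSum] using hx.abs_evenWilton_sub_le 0

/-! ### The defect of the functional equation on `(0, g)` -/

theorem Regular.evenWilton_eq_of_lt {x : ℝ} (hx : Regular x) (h0 : 0 < x) (h1 : x ≤ 1 / 2) :
    evenWilton x = -Real.log x - x * evenWilton (1 / x) := by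
  have h := hx.evenWilton_eq
  rw [logDist, nearDist_of_mem h0.le h1, one_div, Real.log_inv] at h
  rw [h, one_div]

/-- The defect of the functional equation `F(x) = log(1/x) - x F(1/x)` of the even Wilton
function. -/
def defect (x : ℝ) : ℝ := evenWilton x + Real.log x + x * evenWilton (1 / x)

theorem Regular.defect_eq_zero {x : ℝ} (hx : Regular x) (h0 : 0 < x) (h1 : x ≤ 1 / 2) :
    defect x = 0 := by
  rw [defect, hx.evenWilton_eq_of_lt h0 h1]; ring

/-- Thus `g` is the fixed point of the map `x ↦ 1/(1-x) - 2` in the defect recursion. -/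
theorem g_fixed : g + 2 = 1 / (1 - g) := by
  rw [eq_div_iff (by linarith [g_lt])]
  linear_combination -g_sq

/-- The inhomogeneous term in the recursion for `defect`. -/
def defectSource (x : ℝ) : ℝ :=
  (1 + x) * Real.log x - (1 + (1 - x)) * Real.log (1 - x) - (2 * x - 1) * Real.log (2 * x - 1)

theorem abs_defectSource_le {x : ℝ} (h0 : 1 / 2 < x) (h1 : x ≤ g) : |defectSource x| ≤ 4 := by
  have hg := g_lt
  have a1 : Real.log x ≤ 0 := Real.log_nonpos (by linarith) (by linarith)
  have a2 : Real.log (1 - x) ≤ 0 := Real.log_nonpos (by linarith) (by linarith)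
  have a3 : Real.log (2 * x - 1) ≤ 0 := Real.log_nonpos (by linarith) (by linarith)
  have b1 : -1 ≤ Real.log x := by
    have := Real.one_sub_inv_le_log_of_pos (show 0 < x by linarith)
    have h : x⁻¹ ≤ 2 := by
      rw [inv_le_comm₀ (by linarith) (by norm_num)]; linarith
    linarith
  have b2 : -2 ≤ Real.log (1 - x) := by
    have := Real.one_sub_inv_le_log_of_pos (show 0 < 1 - x by linarith)
    have h : (1 - x)⁻¹ ≤ 3 := by
      rw [inv_le_comm₀ (by linarith) (by norm_num)]; linarith
    linarith
  have b3 : -1 ≤ (2 * x - 1) * Real.log (2 * x - 1) := by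
    have h := Real.one_sub_inv_le_log_of_pos (show 0 < 2 * x - 1 by linarith)
    have h' := mul_le_mul_of_nonneg_left h (show 0 ≤ 2 * x - 1 by linarith)
    rw [mul_sub, mul_inv_cancel₀ (by linarith)] at h'
    linarith
  have b3' : (2 * x - 1) * Real.log (2 * x - 1) ≤ 0 :=
    mul_nonpos_of_nonneg_of_nonpos (by linarith) a3
  rw [defectSource, abs_le]
  constructor <;> nlinarith

/-- With `u = 1 - x` and `w = 2x - 1`, the functional equation at `u` and at `w/x` reduces `F(x) =
F(u)` to `F(w/u)` and `F(1/x) = F(w/x)` to `F(x/w)`. Since `x/w = 1 + u/w`, periodicity turns the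
latter into `F(u/w)`. These are the two values of `F` in the defect at `w/u = 1/u - 2`. -/
theorem Regular.defect_eq {x : ℝ} (hx : Regular x) (h0 : 1 / 2 < x) (h1 : x ≤ g) :
    defect x = defectSource x - (1 - x) * defect (1 / (1 - x) - 2) := by
  have hg := g_lt
  have hg' := g_gt
  obtain ⟨u, hu⟩ : ∃ u, u = 1 - x := ⟨_, rfl⟩
  obtain ⟨w, hw⟩ : ∃ w, w = 2 * x - 1 := ⟨_, rfl⟩
  have hx0 : 0 < x := by linarith
  have hu0 : 0 < u := by linarith
  have hw0 : 0 < w := by linarith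
  have hru : Regular u := by simpa [hu] using hx.int_sub 1
  have hv : 1 / u - 2 = w / u := by field_simp; rw [hw, hu]; ring
  have hv' : 1 / (w / u) = u / w := by field_simp
  have hy : 2 - 1 / x = w / x := by field_simp; rw [hw]
  have hy' : 1 / (w / x) = 1 + u / w := by field_simp; rw [hw, hu]; ring
  have hry : Regular (w / x) := by
    rw [← hy]
    simpa using (hx.one_div_of_le hx0 h1).int_sub 2
  have e1 : evenWilton x = evenWilton u := by
    rw [hu]; simpa using (evenPeriodic_evenWilton.int_sub 1 x).symm
  have e2 : evenWilton u = -Real.log u - u * evenWilton (w / u) := by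
    rw [hru.evenWilton_eq_of_lt hu0 (by linarith), ← hv]
    congr 2
    simpa using (evenPeriodic_evenWilton.sub_int (1 / u) 2).symm
  have e3 : evenWilton (1 / x) = evenWilton (w / x) := by
    rw [← hy]
    simpa using (evenPeriodic_evenWilton.int_sub 2 (1 / x)).symm
  have e4 : evenWilton (w / x) = -Real.log (w / x) - w / x * evenWilton (u / w) := by
    have hle : w / x ≤ 1 / 2 := by
      rw [div_le_div_iff₀ hx0 (by norm_num)]; linarith
    rw [hry.evenWilton_eq_of_lt (by positivity) hle, hy']
    congr 2
    simpa [add_comm] using evenPeriodic_evenWilton.add_int (u / w) 1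
  have hl1 : Real.log (w / x) = Real.log w - Real.log x := Real.log_div hw0.ne' hx0.ne'
  have hl2 : Real.log (w / u) = Real.log w - Real.log u := Real.log_div hw0.ne' hu0.ne'
  rw [defect, defect, defectSource, ← hu, ← hw, hv, hv', e3, e4, e1, e2, hl1, hl2]
  field_simp
  rw [hw, hu]
  ring

theorem Regular.abs_defect_le_of_lt {x : ℝ} (hx : Regular x) (h0 : 0 < x) (h1 : x < g) :
    |defect x| ≤ 8 := by
  have hg := g_lt
  have hg' := g_gt
  -- The recursion multiplies the distance to `g` by at least `4`; once that distance is `1/4`, the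
  -- point lies below `1/2`, where the defect vanishes. So `n` bounds the number of steps.
  obtain ⟨n, hn⟩ : ∃ n : ℕ, 1 / 4 ≤ 4 ^ n * (g - x) := by
    obtain ⟨n, hn⟩ := pow_unbounded_of_one_lt (1 / (g - x)) (show (1 : ℝ) < 4 by norm_num)
    refine ⟨n, ?_⟩
    rw [div_lt_iff₀ (by linarith)] at hn
    linarith
  induction n generalizing x with
  | zero => rw [hx.defect_eq_zero h0 (by linarith)]; norm_num
  | succ n ih =>
    rcases le_or_gt x (1 / 2) with hle | hlt
    · rw [hx.defect_eq_zero h0 hle]; norm_num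
    · have hu0 : 0 < 1 - x := by linarith
      have hru : Regular (1 - x) := by simpa using hx.int_sub 1
      have hrv : Regular (1 / (1 - x) - 2) := by
        simpa using (hru.one_div_of_le hu0 (by linarith)).sub_int 2
      have hv0 : 0 < 1 / (1 - x) - 2 := by
        rw [sub_pos, lt_div_iff₀ hu0]; linarith
      have hgap : 4 * (g - x) ≤ g - (1 / (1 - x) - 2) := by
        have hfix := g_fixed
        have : g - (1 / (1 - x) - 2) = (g - x) / ((1 - g) * (1 - x)) := by
          have hg1 : 1 - g ≠ 0 := by linarith
          rw [show g - (1 / (1 - x) - 2) = g + 2 - 1 / (1 - x) by ring, hfix]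
          field_simp
          ring
        rw [this, le_div_iff₀ (mul_pos (by linarith) hu0)]
        have : (1 - g) * (1 - x) ≤ 1 / 4 := by nlinarith
        nlinarith
      have hv := ih hrv hv0 (by linarith) (by
        have : 4 ^ n * (4 * (g - x)) ≤ 4 ^ n * (g - (1 / (1 - x) - 2)) := by gcongr
        refine le_trans ?_ this
        rw [← mul_assoc, ← pow_succ]
        exact hn)
      have hs := abs_defectSource_le hlt h1.le
      rw [hx.defect_eq hlt h1.le]
      calc _ ≤ |defectSource x| + |(1 - x) * defect (1 / (1 - x) - 2)| := abs_sub _ _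
        -- The bound `8` is the one reproduced by `C = 4 + C/2`, so it does not depend on the number
        -- of steps.
        _ ≤ 4 + 1 / 2 * 8 := by
          rw [abs_mul, abs_of_pos hu0]
          gcongr
          linarith
        _ = 8 := by norm_num

theorem Regular.abs_defect_le {x : ℝ} (hx : Regular x) (h0 : 0 < x) (h1 : x ≤ g) :
    |defect x| ≤ 8 := by
  rcases h1.lt_or_eq with h | rfl
  · exact hx.abs_defect_le_of_lt h0 h
  · have hlt : 1 / 2 < g := by linarith [g_gt]
    have h := hx.defect_eq hlt le_rfl
    -- At the fixed point the expansion argument fails, but the recursion becomes a linear equation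
    -- for `defect g` alone.
    rw [← g_fixed, add_sub_cancel_right] at h
    have hs := abs_le.1 (abs_defectSource_le hlt le_rfl)
    have hg := g_lt
    rw [abs_le]
    constructor <;> nlinarith

/-! ### Orbits of the Nakada maps -/

theorem max_le_g {α : ℝ} (hα : α ∈ Set.Icc (1 - g) g) : max α (1 - α) ≤ g :=
  max_le hα.2 (by linarith [hα.1])

theorem startPoint_mem {α : ℝ} (hα : α ∈ Set.Icc (1 - g) g) (x : ℝ) :
    startPoint α x ≤ g := by
  have h1 := Int.floor_le (x + 1 - max α (1 - α))
  have h2 := Int.lt_floor_add_one (x + 1 - max α (1 - α))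
  have h3 := max_le_g hα
  have h4 := le_max_left α (1 - α)
  have h5 := le_max_right α (1 - α)
  rw [startPoint, abs_le]
  constructor <;> linarith

theorem nakadaMap_eq (α : ℝ) {x : ℝ} (hx : x ≠ 0) :
    nakadaMap α x = |1 / x - (⌊1 / x + 1 - α⌋ : ℝ)| := if_neg hx

theorem nakadaMap_le {α : ℝ} (hα : α ∈ Set.Icc (1 - g) g) {x : ℝ} (hx : x ≠ 0) :
    nakadaMap α x ≤ g := by
  have h1 := Int.floor_le (1 / x + 1 - α)
  have h2 := Int.lt_floor_add_one (1 / x + 1 - α)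
  rw [nakadaMap_eq α hx, abs_le]
  constructor <;> linarith [hα.1, hα.2]

variable {α x : ℝ}

theorem orbitPoint_succ (α x : ℝ) (j : ℕ) :
    orbitPoint α x (j + 1) = nakadaMap α (orbitPoint α x j) :=
  Function.iterate_succ_apply' _ _ _

theorem betaPrev_succ (α x : ℝ) (j : ℕ) :
    betaPrev α x (j + 1) = betaPrev α x j * orbitPoint α x j :=
  Finset.prod_range_succ _ _

theorem Regular.orbitPoint_spec (hα : α ∈ Set.Icc (1 - g) g) (hx : Regular x) (j : ℕ) :
    Regular (orbitPoint α x j) ∧ 0 < orbitPoint α x j ∧ orbitPoint α x j ≤ g := by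
  induction j with
  | zero =>
    have h : Regular (orbitPoint α x 0) := hx.abs_sub_int _
    exact ⟨h, lt_of_le_of_ne (abs_nonneg _) h.irrational.ne_zero.symm, startPoint_mem hα x⟩
  | succ j ih =>
    obtain ⟨h1, h2, h3⟩ := ih
    rw [orbitPoint_succ]
    have h : Regular (nakadaMap α (orbitPoint α x j)) := by
      rw [nakadaMap_eq α h2.ne']
      exact (h1.one_div_of_le h2 h3).abs_sub_int _
    refine ⟨h, lt_of_le_of_ne ?_ h.irrational.ne_zero.symm, nakadaMap_le hα h2.ne'⟩
    rw [nakadaMap_eq α h2.ne']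
    exact abs_nonneg _

theorem EvenPeriodic.orbitPoint_zero {β : Type*} {f : ℝ → β} (hf : EvenPeriodic f) :
    f (orbitPoint α x 0) = f x := hf.abs_sub_int x _

theorem EvenPeriodic.orbitPoint_succ {β : Type*} {f : ℝ → β} (hf : EvenPeriodic f) {j : ℕ}
    (h : orbitPoint α x j ≠ 0) : f (orbitPoint α x (j + 1)) = f (1 / orbitPoint α x j) := by
  rw [Wilton.orbitPoint_succ, nakadaMap_eq α h, hf.abs_sub_int]

theorem Regular.betaPrev_nonneg (hα : α ∈ Set.Icc (1 - g) g) (hx : Regular x) (j : ℕ) :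
    0 ≤ betaPrev α x j :=
  Finset.prod_nonneg fun i _ => (hx.orbitPoint_spec hα i).2.1.le

theorem Regular.betaPrev_le (hα : α ∈ Set.Icc (1 - g) g) (hx : Regular x) (j : ℕ) :
    betaPrev α x j ≤ g ^ j := by
  simpa [betaPrev] using
    Finset.prod_le_prod (s := Finset.range j) (fun i _ => (hx.orbitPoint_spec hα i).2.1.le)
      (fun i _ => (hx.orbitPoint_spec hα i).2.2)

/-- Going back one orbit step absorbs one factor of the product and raises the index of the tail by
one. -/
theorem Regular.betaPrev_mul_majorantTail_le (hα : α ∈ Set.Icc (1 - g) g) (hx : Regular x)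
    (N M : ℕ) :
    ENNReal.ofReal (betaPrev α x N) * majorantTail M (orbitPoint α x N) ≤
      majorantTail (N + M) x := by
  induction N generalizing M with
  | zero => simp [betaPrev, (evenPeriodic_majorantTail M).orbitPoint_zero]
  | succ N ih =>
    obtain ⟨-, h2, h3⟩ := hx.orbitPoint_spec hα N
    rw [betaPrev_succ, ENNReal.ofReal_mul (hx.betaPrev_nonneg hα N), mul_assoc,
      (evenPeriodic_majorantTail M).orbitPoint_succ h2.ne', add_assoc, add_comm 1 M]
    refine le_trans (mul_le_mul_right ?_ _) (ih (M + 1))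
    rw [← majorant_majorantTail]
    exact le_majorant _ h2 h3

theorem Regular.tendsto_majorantTail (hx : Regular x) :
    Tendsto (fun N => majorantTail N x) atTop (𝓝 0) :=
  ENNReal.tendsto_sum_nat_add (fun j => majorantIter j x) hx.ne_top

theorem Regular.tendsto_betaPrev_mul_evenWilton (hα : α ∈ Set.Icc (1 - g) g) (hx : Regular x) :
    Tendsto (fun N => (-1) ^ N * betaPrev α x N * evenWilton (orbitPoint α x N)) atTop (𝓝 0) := by
  rw [tendsto_zero_iff_abs_tendsto_zero]
  refine squeeze_zero (fun N => abs_nonneg _) (fun N => ?_)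
    ((ENNReal.tendsto_toReal ENNReal.zero_ne_top).comp hx.tendsto_majorantTail)
  refine (ENNReal.ofReal_le_iff_le_toReal (hx.majorantTail_ne_top N)).1 ?_
  rw [Function.comp_apply, abs_mul, abs_mul, abs_neg_one_pow, one_mul,
    abs_of_nonneg (hx.betaPrev_nonneg hα N),
    ENNReal.ofReal_mul (hx.betaPrev_nonneg hα N)]
  exact (mul_le_mul_right (hx.orbitPoint_spec hα N).1.abs_evenWilton_le _).trans
    (hx.betaPrev_mul_majorantTail_le hα N 0)

/-- Telescoping: the definition of `defect` expresses `log (1 / x_j)` through `F(x_j)` and `F(1/x_j)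
= F(x_{j+1})`. -/
theorem Regular.wiltonPartialSum_eq (hα : α ∈ Set.Icc (1 - g) g) (hx : Regular x) (N : ℕ) :
    wiltonPartialSum α N x = evenWilton x -
      (-1) ^ N * betaPrev α x N * evenWilton (orbitPoint α x N) -
      ∑ j ∈ Finset.range N, (-1) ^ j * betaPrev α x j * defect (orbitPoint α x j) := by
  induction N with
  | zero =>
    simp [wiltonPartialSum, betaPrev, evenPeriodic_evenWilton.orbitPoint_zero]
  | succ N ih =>
    unfold wiltonPartialSum at ih ⊢
    rw [Finset.sum_range_succ, ih, Finset.sum_range_succ, betaPrev_succ,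
      evenPeriodic_evenWilton.orbitPoint_succ (hx.orbitPoint_spec hα N).2.1.ne', wiltonTerm,
      defect, one_div, Real.log_inv]
    ring

/-- The difference between the even Wilton function and the Wilton function. -/
def correction (α x : ℝ) : ℝ :=
  ∑' j, (-1) ^ j * betaPrev α x j * defect (orbitPoint α x j)

theorem Regular.norm_correction_term_le (hα : α ∈ Set.Icc (1 - g) g) (hx : Regular x) (j : ℕ) :
    ‖(-1) ^ j * betaPrev α x j * defect (orbitPoint α x j)‖ ≤ g ^ j * 8 := by
  obtain ⟨h1, h2, h3⟩ := hx.orbitPoint_spec hα j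
  rw [Real.norm_eq_abs, abs_mul, abs_mul, abs_neg_one_pow, one_mul,
    abs_of_nonneg (hx.betaPrev_nonneg hα j)]
  have := g_pos
  gcongr
  · exact hx.betaPrev_le hα j
  · exact h1.abs_defect_le h2 h3

theorem hasSum_g_pow : HasSum (fun j : ℕ => g ^ j * 8) ((1 - g)⁻¹ * 8) :=
  (hasSum_geometric_of_lt_one g_pos.le (by linarith [g_lt])).mul_right 8

theorem Regular.abs_correction_le (hα : α ∈ Set.Icc (1 - g) g) (hx : Regular x) :
    |correction α x| ≤ 24 := by
  rw [← Real.norm_eq_abs]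
  refine (tsum_of_norm_bounded hasSum_g_pow (hx.norm_correction_term_le hα)).trans ?_
  have h : (1 - g)⁻¹ ≤ 3 := by
    rw [inv_le_comm₀ (by linarith [g_lt]) (by norm_num)]
    linarith [g_lt]
  linarith

theorem Regular.tendsto_wiltonPartialSum (hα : α ∈ Set.Icc (1 - g) g) (hx : Regular x) :
    Tendsto (fun N => wiltonPartialSum α N x) atTop (𝓝 (evenWilton x - correction α x)) := by
  have h1 : Summable fun j => (-1) ^ j * betaPrev α x j * defect (orbitPoint α x j) :=
    Summable.of_norm_bounded hasSum_g_pow.summable (hx.norm_correction_term_le hα)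
  have h2 := (tendsto_const_nhds (x := evenWilton x)|>.sub (hx.tendsto_betaPrev_mul_evenWilton hα)).sub
    h1.hasSum.tendsto_sum_nat
  rw [sub_zero] at h2
  exact h2.congr fun N => (hx.wiltonPartialSum_eq hα N).symm

theorem Regular.wiltonFunction_eq (hα : α ∈ Set.Icc (1 - g) g) (hx : Regular x) :
    wiltonFunction α x = evenWilton x - correction α x :=
  (hx.tendsto_wiltonPartialSum hα).limUnder_eq

/-! ### Measurability of the orbit and of the Wilton partial sums -/

theorem measurable_nakadaMap (α : ℝ) : Measurable (nakadaMap α) := by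
  unfold nakadaMap
  refine Measurable.ite (measurableSet_singleton 0) measurable_const ?_
  have h : Measurable fun x : ℝ => 1 / x := measurable_id.const_div 1
  have h2 : Measurable fun x : ℝ => (⌊1 / x + 1 - α⌋ : ℝ) :=
    (measurable_of_countable _).comp (((h.add_const 1).sub_const α).floor)
  exact continuous_abs.measurable.comp (h.sub h2)

theorem measurable_orbitPoint (α : ℝ) (j : ℕ) : Measurable fun x => orbitPoint α x j := by
  induction j with
  | zero =>
    have h2 : Measurable fun x : ℝ => (⌊x + 1 - max α (1 - α)⌋ : ℝ) :=
      (measurable_of_countable _).comp (((measurable_id.add_const 1).sub_const _).floor)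
    exact continuous_abs.measurable.comp (measurable_id.sub h2)
  | succ j ih =>
    simp only [orbitPoint_succ]
    exact (measurable_nakadaMap α).comp ih

theorem measurable_wiltonPartialSum (α : ℝ) (N : ℕ) : Measurable (wiltonPartialSum α N) := by
  refine Finset.measurable_fun_sum _ fun j _ => ?_
  unfold wiltonTerm betaPrev
  exact ((Finset.measurable_fun_prod _ fun i _ => measurable_orbitPoint α i).const_mul _).mul
    (Real.measurable_log.comp ((measurable_orbitPoint α j).const_div 1))

/-! ### Mean oscillation of even periodic functions -/

theorem EvenPeriodic.setLIntegral_int_sub {k : ℝ → ℝ≥0∞} (hk : EvenPeriodic k) (n : ℤ) (a b : ℝ) :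
    ∫⁻ x in Set.Icc (n - b) (n - a), k x = ∫⁻ x in Set.Icc a b, k x := by
  have h := lintegral_sub_left_eq_self (μ := volume)
    ((Set.Icc (n - b) (n - a)).indicator k) (n : ℝ)
  rw [lintegral_indicator measurableSet_Icc] at h
  rw [← h, ← lintegral_indicator measurableSet_Icc]
  refine lintegral_congr fun x => ?_
  by_cases hx : x ∈ Set.Icc a b
  · rw [Set.indicator_of_mem hx, Set.indicator_of_mem, hk.int_sub]
    exact ⟨by linarith [hx.2], by linarith [hx.1]⟩
  · rw [Set.indicator_of_notMem hx, Set.indicator_of_notMem]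
    exact fun h' => hx ⟨by linarith [h'.2], by linarith [h'.1]⟩

theorem EvenPeriodic.setLIntegral_sub_int {k : ℝ → ℝ≥0∞} (hk : EvenPeriodic k) (n : ℤ) (a b : ℝ) :
    ∫⁻ x in Set.Icc (a - n) (b - n), k x = ∫⁻ x in Set.Icc a b, k x := by
  rw [← hk.setLIntegral_int_sub 0, ← hk.setLIntegral_int_sub n]
  congr 3 <;> simp

/-- The mean oscillation of `f` over `[a, b]`, measured with the best constant, is at most `M`. -/
def OscLe (f : ℝ → ℝ) (a b M : ℝ) : Prop :=
  ∃ c : ℝ, ∫⁻ x in Set.Icc a b, ENNReal.ofReal |f x - c| ≤ ENNReal.ofReal (M * (b - a))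

theorem OscLe.mono {f : ℝ → ℝ} {a b M M' : ℝ} (h : OscLe f a b M) (hM : M ≤ M') (hab : a ≤ b) :
    OscLe f a b M' := by
  obtain ⟨c, hc⟩ := h
  exact ⟨c, hc.trans (ENNReal.ofReal_le_ofReal
    (mul_le_mul_of_nonneg_right hM (by linarith)))⟩

theorem EvenPeriodic.oscLe_int_sub {f : ℝ → ℝ} (hf : EvenPeriodic f) (n : ℤ) {a b M : ℝ} :
    OscLe f (n - b) (n - a) M ↔ OscLe f a b M := by
  refine exists_congr fun c => ?_
  rw [(hf.comp fun y => ENNReal.ofReal |y - c|).setLIntegral_int_sub]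
  simp

theorem EvenPeriodic.oscLe_sub_int {f : ℝ → ℝ} (hf : EvenPeriodic f) (n : ℤ) {a b M : ℝ} :
    OscLe f (a - n) (b - n) M ↔ OscLe f a b M := by
  refine exists_congr fun c => ?_
  rw [(hf.comp fun y => ENNReal.ofReal |y - c|).setLIntegral_sub_int]
  simp

theorem setLIntegral_log_sub_log {b : ℝ} (hb : 0 < b) :
    ∫⁻ x in Set.Ioc 0 b, ENNReal.ofReal (Real.log b - Real.log x) = ENNReal.ofReal b := by
  have hi : IntervalIntegrable (fun x => Real.log b - Real.log x) volume 0 b :=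
    intervalIntegrable_const.sub intervalIntegral.intervalIntegrable_log'
  rw [← ofReal_integral_eq_lintegral_ofReal
    ((intervalIntegrable_iff_integrableOn_Ioc_of_le hb.le).1 hi),
    ← intervalIntegral.integral_of_le hb.le,
    intervalIntegral.integral_sub intervalIntegrable_const
      intervalIntegral.intervalIntegrable_log', integral_log]
  · simp
  · refine (ae_restrict_iff' measurableSet_Ioc).2 (ae_of_all _ fun x hx => ?_)
    simpa using Real.log_le_log hx.1 hx.2

section

variable {f : ℝ → ℝ} {L : ℝ}

theorem setLIntegral_comp_inv_le_mul (hf : EvenPeriodic f)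
    (hL : ∫⁻ x in Set.Ioc (0 : ℝ) 1, ENNReal.ofReal |f x| ≤ ENNReal.ofReal L) {b : ℝ}
    (hb0 : 0 < b) (hb : b ≤ 1 / 2) :
    ∫⁻ x in Set.Ioc 0 b, ENNReal.ofReal (x * |f (1 / x)|) ≤ ENNReal.ofReal (b * L) := by
  calc _ ≤ ∫⁻ x in Set.Ioc 0 b, ENNReal.ofReal b * ENNReal.ofReal |f (1 / x)| := by
        refine setLIntegral_mono' measurableSet_Ioc fun x hx => ?_
        rw [← ENNReal.ofReal_mul hb0.le]
        exact ENNReal.ofReal_le_ofReal (mul_le_mul_of_nonneg_right hx.2 (abs_nonneg _))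
    _ = ENNReal.ofReal b * ∫⁻ x in Set.Ioc 0 b, ENNReal.ofReal |f (1 / x)| :=
        lintegral_const_mul' _ _ ENNReal.ofReal_ne_top
    _ ≤ ENNReal.ofReal b * ∫⁻ x in Set.Ioc 0 (1 / 2), ENNReal.ofReal |f (1 / x)| := by
        gcongr
    _ ≤ ENNReal.ofReal b * ENNReal.ofReal L := by
        gcongr
        exact (setLIntegral_comp_inv_half_le
          (hf.comp fun y => ENNReal.ofReal |y|).periodic).trans hL
    _ = _ := (ENNReal.ofReal_mul hb0.le).symm

theorem sub_transfer_of_mem {x : ℝ} (h0 : 0 < x) (h1 : x ≤ 1 / 2) :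
    logDist x - transfer f x = -Real.log x - x * f (1 / x) := by
  rw [logDist, transfer, nearDist_of_mem h0.le h1, one_div, Real.log_inv]

theorem evenPeriodic_sub_transfer (f : ℝ → ℝ) :
    EvenPeriodic fun x => logDist x - transfer f x where
  periodic x := by
    simp only [evenPeriodic_logDist.periodic x, (evenPeriodic_transfer f).periodic x]
  even x := by
    simp only [evenPeriodic_logDist.even x, (evenPeriodic_transfer f).even x]

/-- The logarithm deviates from its value at `b` by exactly `b` in `L¹`; the transfer term costs `b
* L` because its weight `x` is at most `b`. No oscillation bound on `f` is needed. -/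
theorem setLIntegral_sub_transfer_le (hf : EvenPeriodic f)
    (hL : ∫⁻ x in Set.Ioc (0 : ℝ) 1, ENNReal.ofReal |f x| ≤ ENNReal.ofReal L) (hL0 : 0 ≤ L)
    {b : ℝ} (hb0 : 0 < b) (hb : b ≤ 1 / 2) :
    ∫⁻ x in Set.Icc 0 b, ENNReal.ofReal |logDist x - transfer f x - -Real.log b| ≤
      ENNReal.ofReal (b * (1 + L)) := by
  rw [setLIntegral_congr Ioc_ae_eq_Icc.symm, mul_add, mul_one,
    ENNReal.ofReal_add hb0.le (by positivity), ← setLIntegral_log_sub_log hb0]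
  refine le_trans ?_ (add_le_add_right (setLIntegral_comp_inv_le_mul hf hL hb0 hb) _)
  rw [← lintegral_add_left (Real.measurable_log.const_sub _).ennreal_ofReal]
  refine setLIntegral_mono' measurableSet_Ioc fun x hx => ?_
  have hlog : 0 ≤ Real.log b - Real.log x := sub_nonneg.2 (Real.log_le_log hx.1 hx.2)
  rw [← ENNReal.ofReal_add hlog (mul_nonneg hx.1.le (abs_nonneg _)),
    sub_transfer_of_mem hx.1 (hx.2.trans hb)]
  refine ENNReal.ofReal_le_ofReal ?_
  calc |-Real.log x - x * f (1 / x) - -Real.log b|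
      = |(Real.log b - Real.log x) - x * f (1 / x)| := by congr 1; ring
    _ ≤ |Real.log b - Real.log x| + |x * f (1 / x)| := abs_sub _ _
    _ = _ := by rw [abs_of_nonneg hlog, abs_mul, abs_of_pos hx.1]

/-- Oscillation over intervals that are close to `0` in comparison with their length. -/
theorem oscLe_sub_transfer_of_near_zero (hf : EvenPeriodic f)
    (hL : ∫⁻ x in Set.Ioc (0 : ℝ) 1, ENNReal.ofReal |f x| ≤ ENNReal.ofReal L) (hL0 : 0 ≤ L)
    {a b : ℝ} (hab : -b ≤ a) (hb0 : 0 < b) (hb : b ≤ 1 / 2) (hlen : b ≤ 3 * (b - a)) :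
    OscLe (fun x => logDist x - transfer f x) a b (6 * (1 + L)) := by
  refine ⟨-Real.log b, ?_⟩
  have hk := (evenPeriodic_sub_transfer f).comp fun y => ENNReal.ofReal |y - -Real.log b|
  have h0 := setLIntegral_sub_transfer_le hf hL hL0 hb0 hb
  have h1 := hk.setLIntegral_int_sub 0 0 b
  rw [Int.cast_zero, zero_sub, sub_zero] at h1
  have hsub : Set.Icc a b ⊆ Set.Icc (-b) 0 ∪ Set.Icc 0 b := by
    rw [Set.Icc_union_Icc_eq_Icc (by linarith) hb0.le]
    exact Set.Icc_subset_Icc_left hab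
  refine (lintegral_mono_set hsub).trans ((lintegral_union_le _ _ _).trans ?_)
  rw [h1]
  refine (add_le_add h0 h0).trans ?_
  rw [← ENNReal.ofReal_add (by positivity) (by positivity)]
  refine ENNReal.ofReal_le_ofReal ?_
  nlinarith

/-- Oscillation over intervals that are far from `0` in comparison with their length. -/
theorem oscLe_sub_transfer_of_inv (hf : EvenPeriodic f) (hm : Measurable f)
    (hL : ∫⁻ x in Set.Ioc (0 : ℝ) 1, ENNReal.ofReal |f x| ≤ ENNReal.ofReal L) (hL0 : 0 ≤ L)
    {a b M : ℝ} (hM : 0 ≤ M) (ha : 0 < a) (hab : a ≤ b) (hb : b ≤ 1 / 2) (hba : b ≤ 3 / 2 * a)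
    (hosc : OscLe f (1 / b) (1 / a) M) :
    OscLe (fun x => logDist x - transfer f x) a b (M / 2 + (1 + L)) := by
  obtain ⟨c, hc⟩ := hosc
  have hb0 : 0 < b := ha.trans_le hab
  have hba0 : 0 ≤ b - a := by linarith
  have hinv : 1 / a - 1 / b = (b - a) / (a * b) := by field_simp
  -- Freeze the logarithm and the weight `x` at `a`. The error `(x - a) f(1/x)` is then handled by
  -- the `L¹` bound.
  refine ⟨-Real.log a - a * c, ?_⟩
  have hpt : ∀ x ∈ Set.Icc a b, ENNReal.ofReal
      |logDist x - transfer f x - (-Real.log a - a * c)| ≤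
      ENNReal.ofReal (1 / 2) + ENNReal.ofReal a * ENNReal.ofReal |f (1 / x) - c| +
        ENNReal.ofReal (b - a) * ENNReal.ofReal |f (1 / x)| := by
    intro x hx
    have hx0 : 0 < x := ha.trans_le hx.1
    rw [← ENNReal.ofReal_mul ha.le, ← ENNReal.ofReal_mul hba0,
      ← ENNReal.ofReal_add (by norm_num) (by positivity),
      ← ENNReal.ofReal_add (by positivity) (by positivity),
      sub_transfer_of_mem hx0 (hx.2.trans hb)]
    refine ENNReal.ofReal_le_ofReal ?_
    have hlog0 : 0 ≤ Real.log x - Real.log a := sub_nonneg.2 (Real.log_le_log ha hx.1)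
    have hlog : Real.log x - Real.log a ≤ 1 / 2 := by
      rw [← Real.log_div hx0.ne' ha.ne']
      refine (Real.log_le_sub_one_of_pos (by positivity)).trans ?_
      have : x / a ≤ 3 / 2 := by
        rw [div_le_iff₀ ha]; linarith [hx.2]
      linarith
    calc |-Real.log x - x * f (1 / x) - (-Real.log a - a * c)|
        = |(Real.log x - Real.log a) + a * (f (1 / x) - c) + (x - a) * f (1 / x)| := by
          rw [← abs_neg]; congr 1; ring
      _ ≤ |Real.log x - Real.log a| + |a * (f (1 / x) - c)| + |(x - a) * f (1 / x)| :=
          abs_add_three _ _ _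
      _ ≤ _ := by
          rw [abs_mul, abs_mul, abs_of_nonneg hlog0, abs_of_pos ha,
            abs_of_nonneg (show 0 ≤ x - a by linarith [hx.1])]
          gcongr
          exact hx.2
  have hmi : Measurable fun x => f (1 / x) := hm.comp (measurable_id.const_div 1)
  have hm1 : Measurable fun x => ENNReal.ofReal a * ENNReal.ofReal |f (1 / x) - c| :=
    (continuous_abs.measurable.comp (hmi.sub_const c)).ennreal_ofReal.const_mul _
  have hm2 : Measurable fun x => ENNReal.ofReal (1 / 2) +
      ENNReal.ofReal a * ENNReal.ofReal |f (1 / x) - c| := measurable_const.add hm1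
  have i1 : ENNReal.ofReal a * ∫⁻ x in Set.Icc a b, ENNReal.ofReal |f (1 / x) - c| ≤
      ENNReal.ofReal (M / 2 * (b - a)) := by
    refine (mul_le_mul_right ((setLIntegral_comp_inv_le ha hab
      fun y => ENNReal.ofReal |f y - c|).trans (mul_le_mul_right hc _)) _).trans ?_
    rw [← ENNReal.ofReal_mul (by positivity), ← ENNReal.ofReal_mul ha.le, hinv]
    refine ENNReal.ofReal_le_ofReal ?_
    -- Weight, Jacobian and change of length combine to the factor `b ≤ 1/2`, which halves the
    -- oscillation constant.
    have : a * (b ^ 2 * (M * ((b - a) / (a * b)))) = b * (M * (b - a)) := by field_simp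
    rw [this]
    have := mul_le_mul_of_nonneg_right hb (mul_nonneg hM hba0)
    linarith
  have i2 : ENNReal.ofReal (b - a) * ∫⁻ x in Set.Icc a b, ENNReal.ofReal |f (1 / x)| ≤
      ENNReal.ofReal (1 / 2 * L * (b - a)) := by
    refine (mul_le_mul_right ((setLIntegral_comp_inv_le ha hab
      fun y => ENNReal.ofReal |f y|).trans (mul_le_mul_right
        ((setLIntegral_Icc_le_of_periodic (hf.comp fun y => ENNReal.ofReal |y|).periodic
          (one_div_le_one_div_of_le ha hab)).trans (mul_le_mul_right hL _)) _)) _).trans ?_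
    have hJ : 0 ≤ (b - a) / (a * b) := by positivity
    rw [hinv, ← ENNReal.ofReal_mul (by positivity), ← ENNReal.ofReal_mul (by positivity),
      ← ENNReal.ofReal_mul hba0]
    refine ENNReal.ofReal_le_ofReal ?_
    have h1 : b ^ 2 * ((b - a) / (a * b) + 1) ≤ 1 / 2 := by
      have : b ^ 2 * ((b - a) / (a * b) + 1) = b * ((b - a) / a) + b ^ 2 := by field_simp
      rw [this]
      have h2 : (b - a) / a ≤ 1 / 2 := by
        rw [div_le_iff₀ ha]; linarith
      have h3 : 0 ≤ (b - a) / a := by positivity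
      nlinarith
    calc (b - a) * (b ^ 2 * (((b - a) / (a * b) + 1) * L))
        = (b ^ 2 * ((b - a) / (a * b) + 1)) * (L * (b - a)) := by ring
      _ ≤ 1 / 2 * (L * (b - a)) := by gcongr
      _ = _ := by ring
  calc _ ≤ ∫⁻ x in Set.Icc a b, (ENNReal.ofReal (1 / 2) +
          ENNReal.ofReal a * ENNReal.ofReal |f (1 / x) - c| +
          ENNReal.ofReal (b - a) * ENNReal.ofReal |f (1 / x)|) :=
        setLIntegral_mono' measurableSet_Icc hpt
    _ = ENNReal.ofReal (1 / 2 * (b - a)) +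
          ENNReal.ofReal a * (∫⁻ x in Set.Icc a b, ENNReal.ofReal |f (1 / x) - c|) +
          ENNReal.ofReal (b - a) * ∫⁻ x in Set.Icc a b, ENNReal.ofReal |f (1 / x)| := by
        rw [lintegral_add_left hm2, lintegral_add_left measurable_const,
          lintegral_const_mul' _ _ ENNReal.ofReal_ne_top,
          lintegral_const_mul' _ _ ENNReal.ofReal_ne_top, setLIntegral_const, Real.volume_Icc,
          ← ENNReal.ofReal_mul (by norm_num)]
    _ ≤ ENNReal.ofReal (1 / 2 * (b - a)) + ENNReal.ofReal (M / 2 * (b - a)) +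
          ENNReal.ofReal (1 / 2 * L * (b - a)) := by gcongr
    _ ≤ _ := by
        rw [← ENNReal.ofReal_add (by positivity) (by positivity),
          ← ENNReal.ofReal_add (by positivity) (by positivity)]
        refine ENNReal.ofReal_le_ofReal ?_
        nlinarith [mul_nonneg hL0 hba0]

/-- Oscillation over short intervals around `1/2`, leaning to the left. -/
theorem oscLe_sub_transfer_of_mem_half (hf : EvenPeriodic f) (hm : Measurable f)
    (hL : ∫⁻ x in Set.Ioc (0 : ℝ) 1, ENNReal.ofReal |f x| ≤ ENNReal.ofReal L) (hL0 : 0 ≤ L)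
    (hnear : ∀ r, 0 < r → r ≤ 1 / 2 → OscLe f 0 r (6 * (1 + L)))
    {a b : ℝ} (ha : a < 1 / 2) (hb : 1 / 2 < b) (hmid : a + b ≤ 1) (hlen : b - a ≤ 1 / 10) :
    OscLe (fun x => logDist x - transfer f x) a b (8 * (1 + L)) := by
  have ha0 : 0 < a := by linarith
  -- The inverted interval starts at the integer `2`, so after translation it abuts `0` and `hnear`
  -- applies.
  have hJ : OscLe f (1 / (1 / 2)) (1 / a) (6 * (1 + L)) := by
    have h := hnear (1 / a - 2) (by rw [sub_pos, lt_div_iff₀ ha0]; linarith)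
      (by rw [sub_le_iff_le_add, div_le_iff₀ ha0]; linarith)
    have h2 := (hf.oscLe_sub_int 2 (a := 1 / (1 / 2)) (b := 1 / a) (M := 6 * (1 + L))).1
    refine h2 ?_
    norm_num
    simpa using h
  obtain ⟨c, hc⟩ := oscLe_sub_transfer_of_inv hf hm hL hL0 (by positivity) ha0 ha.le le_rfl
    (by linarith) hJ
  refine ⟨c, ?_⟩
  have hk := (evenPeriodic_sub_transfer f).comp fun y => ENNReal.ofReal |y - c|
  have h1 := hk.setLIntegral_int_sub 1 a (1 / 2)
  -- Since the midpoint is at most `1/2`, reflecting the left piece in `1/2` covers the right piece.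
  have hsub : Set.Icc a b ⊆ Set.Icc a (1 / 2) ∪ Set.Icc ((1 : ℤ) - 1 / 2) ((1 : ℤ) - a) := by
    rw [Int.cast_one, show (1 : ℝ) - 1 / 2 = 1 / 2 by norm_num,
      Set.Icc_union_Icc_eq_Icc ha.le (by linarith)]
    exact Set.Icc_subset_Icc_right (by linarith)
  refine (lintegral_mono_set hsub).trans ((lintegral_union_le _ _ _).trans ?_)
  rw [h1]
  refine (add_le_add hc hc).trans ?_
  have : 0 ≤ 1 / 2 - a := by linarith
  rw [← ENNReal.ofReal_add (by positivity) (by positivity)]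
  refine ENNReal.ofReal_le_ofReal ?_
  nlinarith

theorem oscLe_of_long (hf : EvenPeriodic f)
    (hL : ∫⁻ x in Set.Ioc (0 : ℝ) 1, ENNReal.ofReal |f x| ≤ ENNReal.ofReal L) (hL0 : 0 ≤ L)
    {a b : ℝ} (hlen : 1 / 10 < b - a) : OscLe f a b (11 * (1 + L)) := by
  refine ⟨0, ?_⟩
  simp only [sub_zero]
  refine (setLIntegral_Icc_le_of_periodic (hf.comp fun y => ENNReal.ofReal |y|).periodic
    (by linarith)).trans ((mul_le_mul_right hL _).trans ?_)
  rw [← ENNReal.ofReal_mul (by linarith)]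
  refine ENNReal.ofReal_le_ofReal ?_
  nlinarith

end

/-- To bound the oscillation of an even periodic function it suffices to consider intervals with
midpoint in `[0, 1/2]`. -/
theorem EvenPeriodic.oscLe_of_mid {f : ℝ → ℝ} (hf : EvenPeriodic f) {M : ℝ}
    (h : ∀ a b, a < b → 0 ≤ a + b → a + b ≤ 1 → OscLe f a b M) {a b : ℝ} (hab : a < b) :
    OscLe f a b M := by
  set m := (a + b) / 2 with hmdef
  have hm := abs_le.1 (abs_sub_round m)
  rw [← hf.oscLe_sub_int (round m)]
  rcases le_total 0 (m - round m) with h0 | h0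
  · exact h _ _ (by linarith) (by linarith) (by linarith)
  · rw [← hf.oscLe_int_sub 0, Int.cast_zero, zero_sub, zero_sub]
    exact h _ _ (by linarith) (by linarith) (by linarith)

theorem oscLe_evenPartialSum {L : ℝ} (hL0 : 0 ≤ L)
    (hL : ∀ N, ∫⁻ x in Set.Ioc (0 : ℝ) 1, ENNReal.ofReal |evenPartialSum N x| ≤ ENNReal.ofReal L)
    (N : ℕ) {a b : ℝ} (hab : a < b) : OscLe (evenPartialSum N) a b (11 * (1 + L)) := by
  induction N generalizing a b with
  | zero =>
    refine ⟨0, ?_⟩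
    simp [evenPartialSum]
  | succ N ih =>
    have hf := evenPeriodic_evenPartialSum N
    have hm := measurable_evenPartialSum N
    have heq : evenPartialSum (N + 1) = fun x => logDist x - transfer (evenPartialSum N) x :=
      funext (evenPartialSum_succ N)
    -- Crossing `1/2` doubles the constant, so using `ih` there would give `13 * (1 + L)` and not
    -- close the induction. The smaller constant near `0` needs no induction hypothesis.
    have hnear : ∀ r, 0 < r → r ≤ 1 / 2 → OscLe (evenPartialSum N) 0 r (6 * (1 + L)) := by
      intro r hr0 hr
      cases N with
      | zero =>
        refine ⟨0, ?_⟩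
        simp [evenPartialSum]
      | succ n =>
        rw [show evenPartialSum (n + 1) = fun x => logDist x - transfer (evenPartialSum n) x from
          funext (evenPartialSum_succ n)]
        exact oscLe_sub_transfer_of_near_zero (evenPeriodic_evenPartialSum n) (hL n) hL0
          (by linarith) hr0 hr (by linarith)
    refine (evenPeriodic_evenPartialSum (N + 1)).oscLe_of_mid (fun a b hab h0 h1 => ?_) hab
    -- Above this length `b - a + 1 ≤ 11 * (b - a)`, the source of the `11`. Below it, `b > 1/2`
    -- forces `a > 2/5`, hence `1/a - 2 ≤ 1/2`; and `b > 3/2 * a` forces `b < 1/2`.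
    rcases lt_or_ge (1 / 10) (b - a) with hlong | hshort
    · exact oscLe_of_long (evenPeriodic_evenPartialSum (N + 1)) (hL _) hL0 hlong
    rw [heq]
    rcases lt_or_ge (3 / 2 * a) b with hnz | hfar
    · exact (oscLe_sub_transfer_of_near_zero hf (hL N) hL0 (by linarith) (by linarith)
        (by linarith) (by linarith)).mono (by linarith) hab.le
    rcases le_or_gt b (1 / 2) with hb | hb
    · have ha : 0 < a := by linarith
      exact (oscLe_sub_transfer_of_inv hf hm (hL N) hL0 (by positivity) ha hab.le hb hfar
        (ih (one_div_lt_one_div_of_lt ha hab))).mono (by linarith) hab.le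
    · exact (oscLe_sub_transfer_of_mem_half hf hm (hL N) hL0 hnear (by linarith) hb h1
        hshort).mono (by linarith) hab.le

/-! ### Bounded mean oscillation -/

/-- The mean is within `M` of any admissible constant `c`, so replacing `c` by the mean at most
doubles the bound. -/
theorem memBMO_of_oscLe {f : ℝ → ℝ} (hf : LocallyIntegrable f volume) {M : ℝ} (hM : 0 ≤ M)
    (h : ∀ a b, a < b → OscLe f a b M) : MemBMO f := by
  refine ⟨hf, 2 * M, fun a b hab => ?_⟩
  obtain ⟨c, hc⟩ := h a b hab
  have hba : 0 < b - a := sub_pos.2 hab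
  have hfi : IntervalIntegrable f volume a b :=
    (intervalIntegrable_iff_integrableOn_Icc_of_le hab.le).2
      (hf.integrableOn_isCompact isCompact_Icc)
  have hi : IntervalIntegrable (fun x => |f x - c|) volume a b :=
    (hfi.sub intervalIntegrable_const).abs
  have hosc : ∫ x in a..b, |f x - c| ≤ M * (b - a) := by
    rw [← ENNReal.ofReal_le_ofReal_iff (by positivity), intervalIntegral.integral_of_le hab.le,
      ofReal_integral_eq_lintegral_ofReal
        ((intervalIntegrable_iff_integrableOn_Ioc_of_le hab.le).1 hi)
        (ae_of_all _ fun x => abs_nonneg _), setLIntegral_congr Ioc_ae_eq_Icc]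
    exact hc
  set A := ⨍ y in a..b, f y with hA
  have hAc : |c - A| ≤ M := by
    have h1 : (A - c) * (b - a) = ∫ x in a..b, (f x - c) := by
      rw [intervalIntegral.integral_sub hfi intervalIntegrable_const,
        intervalIntegral.integral_const, hA, interval_average_eq_div, smul_eq_mul]
      field_simp
    have h2 : |A - c| * (b - a) ≤ M * (b - a) := by
      rw [← abs_of_pos hba, ← abs_mul, abs_of_pos hba, h1]
      exact (intervalIntegral.abs_integral_le_integral_abs hab.le).trans hosc
    rw [abs_sub_comm]
    exact le_of_mul_le_mul_right h2 hba
  rw [interval_average_eq_div, div_le_iff₀ hba]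
  calc ∫ x in a..b, |f x - A| ≤ ∫ x in a..b, (|f x - c| + M) := by
        refine intervalIntegral.integral_mono_on hab.le
          (hfi.sub intervalIntegrable_const).abs (hi.add intervalIntegrable_const)
          fun x _ => ?_
        exact (abs_sub_le _ c _).trans (by linarith)
    _ = (∫ x in a..b, |f x - c|) + M * (b - a) := by
        rw [intervalIntegral.integral_add hi intervalIntegrable_const,
          intervalIntegral.integral_const, smul_eq_mul, mul_comm]
    _ ≤ 2 * M * (b - a) := by linarith

/-! ### From the partial sums of `evenWilton` to `W_α` -/

/-- The integral over a period of the dominating series. -/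
def majorantMass : ℝ := (∫⁻ x in Set.Ioc (0 : ℝ) 1, majorantTail 0 x).toReal

theorem majorantMass_nonneg : 0 ≤ majorantMass := ENNReal.toReal_nonneg

theorem lintegral_evenPartialSum_le (N : ℕ) :
    ∫⁻ x in Set.Ioc (0 : ℝ) 1, ENNReal.ofReal |evenPartialSum N x| ≤
      ENNReal.ofReal majorantMass := by
  rw [majorantMass, ENNReal.ofReal_toReal lintegral_majorantTail_zero_ne_top]
  exact lintegral_mono fun x => ofReal_abs_evenPartialSum_le N x

theorem oscLe_wiltonFunction {α : ℝ} (hα : α ∈ Set.Icc (1 - g) g) {a b : ℝ} (hab : a < b) :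
    OscLe (wiltonFunction α) a b (11 * (1 + majorantMass) + 25) := by
  have hba : 0 < b - a := sub_pos.2 hab
  have hmass := majorantMass_nonneg
  -- `N` may depend on the interval because the oscillation bound is uniform in `N`. The tail over
  -- `[a, b]` costs at most `b - a + 1` periods, hence at most `b - a`; with the `24` for the
  -- correction this makes the `25`.
  obtain ⟨N, hN⟩ := (tendsto_lintegral_majorantTail.eventually_lt_const
    (ENNReal.ofReal_pos.2 (show 0 < (b - a) / (b - a + 1) by positivity))).exists
  obtain ⟨c, hc⟩ := oscLe_evenPartialSum hmass lintegral_evenPartialSum_le N hab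
  refine ⟨c, ?_⟩
  have htail : ∫⁻ x in Set.Icc a b, majorantTail N x ≤ ENNReal.ofReal (b - a) := by
    refine (setLIntegral_Icc_le_of_periodic (evenPeriodic_majorantTail N).periodic hab.le).trans
      ((mul_le_mul_right hN.le _).trans ?_)
    rw [← ENNReal.ofReal_mul (by positivity), mul_div_cancel₀ _ (by positivity)]
  have hm : Measurable fun x => ENNReal.ofReal |evenPartialSum N x - c| :=
    (continuous_abs.measurable.comp
      ((measurable_evenPartialSum N).sub_const c)).ennreal_ofReal
  calc ∫⁻ x in Set.Icc a b, ENNReal.ofReal |wiltonFunction α x - c|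
      ≤ ∫⁻ x in Set.Icc a b, (ENNReal.ofReal |evenPartialSum N x - c| +
          (majorantTail N x + ENNReal.ofReal 24)) := by
        refine lintegral_mono_ae (ae_restrict_of_ae ?_)
        filter_upwards [ae_regular] with x hx
        refine le_trans ?_ (add_le_add_right (add_le_add (hx.abs_evenWilton_sub_le N)
          (ENNReal.ofReal_le_ofReal (hx.abs_correction_le hα))) _)
        rw [← ENNReal.ofReal_add (abs_nonneg _) (abs_nonneg _),
          ← ENNReal.ofReal_add (abs_nonneg _) (by positivity), hx.wiltonFunction_eq hα]
        refine ENNReal.ofReal_le_ofReal ?_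
        calc |evenWilton x - correction α x - c| = |(evenPartialSum N x - c) +
              (evenWilton x - evenPartialSum N x) + -correction α x| := by congr 1; ring
          _ ≤ |evenPartialSum N x - c| + |evenWilton x - evenPartialSum N x| +
              |-correction α x| := abs_add_three _ _ _
          _ = _ := by rw [abs_neg, add_assoc]
    _ = (∫⁻ x in Set.Icc a b, ENNReal.ofReal |evenPartialSum N x - c|) +
          ((∫⁻ x in Set.Icc a b, majorantTail N x) + ENNReal.ofReal (24 * (b - a))) := by
        rw [lintegral_add_left hm, lintegral_add_left (measurable_majorantTail N),
          setLIntegral_const, Real.volume_Icc, ← ENNReal.ofReal_mul (by norm_num)]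
    _ ≤ ENNReal.ofReal (11 * (1 + majorantMass) * (b - a)) +
          (ENNReal.ofReal (b - a) + ENNReal.ofReal (24 * (b - a))) := by gcongr
    _ = _ := by
        rw [← ENNReal.ofReal_add (by positivity) (by positivity),
          ← ENNReal.ofReal_add (by positivity) (by positivity)]
        congr 1
        ring

theorem aestronglyMeasurable_wiltonFunction {α : ℝ} (hα : α ∈ Set.Icc (1 - g) g) :
    AEStronglyMeasurable (wiltonFunction α) volume := by
  refine aestronglyMeasurable_of_tendsto_ae atTop
    (fun N => (measurable_wiltonPartialSum α N).aestronglyMeasurable) ?_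
  filter_upwards [ae_regular] with x hx
  rw [hx.wiltonFunction_eq hα]
  exact hx.tendsto_wiltonPartialSum hα

theorem locallyIntegrable_wiltonFunction {α : ℝ} (hα : α ∈ Set.Icc (1 - g) g) :
    LocallyIntegrable (wiltonFunction α) volume := by
  intro y
  refine ⟨Set.Icc (y - 1) (y + 1), Icc_mem_nhds (by linarith) (by linarith),
    (aestronglyMeasurable_wiltonFunction hα).restrict, ?_⟩
  have hbound : ∫⁻ x in Set.Icc (y - 1) (y + 1), ‖wiltonFunction α x‖ₑ ≤
      ∫⁻ x in Set.Icc (y - 1) (y + 1), (majorantTail 0 x + ENNReal.ofReal 24) := by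
    refine lintegral_mono_ae (ae_restrict_of_ae ?_)
    filter_upwards [ae_regular] with x hx
    rw [hx.wiltonFunction_eq hα, Real.enorm_eq_ofReal_abs]
    refine le_trans ?_ (add_le_add hx.abs_evenWilton_le
      (ENNReal.ofReal_le_ofReal (hx.abs_correction_le hα)))
    rw [← ENNReal.ofReal_add (abs_nonneg _) (abs_nonneg _)]
    exact ENNReal.ofReal_le_ofReal (abs_sub _ _)
  refine lt_of_le_of_lt hbound ?_
  rw [lintegral_add_left (measurable_majorantTail 0), setLIntegral_const, Real.volume_Icc]
  refine ENNReal.add_lt_top.2 ⟨?_, ENNReal.mul_lt_top ENNReal.ofReal_lt_top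
    ENNReal.ofReal_lt_top⟩
  refine lt_of_le_of_lt (setLIntegral_Icc_le_of_periodic
    (evenPeriodic_majorantTail 0).periodic (by linarith)) ?_
  exact ENNReal.mul_lt_top ENNReal.ofReal_lt_top
    (lt_top_iff_ne_top.2 lintegral_majorantTail_zero_ne_top)

end Wilton

end

theorem theorem1p1 (α : ℝ) (hα : α ∈ Set.Icc (1 - Wilton.g) Wilton.g) :
    (∀ᵐ x : ℝ ∂MeasureTheory.volume, Wilton.WiltonConverges α x) ∧
      Wilton.MemBMO (Wilton.wiltonFunction α) := by
  refine ⟨?_, Wilton.memBMO_of_oscLe (Wilton.locallyIntegrable_wiltonFunction hα) ?_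
    fun a b hab => Wilton.oscLe_wiltonFunction hα hab⟩
  · filter_upwards [Wilton.ae_regular] with x hx
    exact ⟨_, hx.tendsto_wiltonPartialSum hα⟩
  · linarith [Wilton.majorantMass_nonneg]
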